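/- **Theorem (well-posedness and finite element approximation of the corrector problem).** Let $n\ge 1$, $Y=(0,1)^n$, and let $\lambda,\Lambda>0$, $\delta\in\left(\frac{n}{n+\pi^2},1\right]$. Then there is a constant $C=C(\lambda,\Lambda,\delta,n)>0$ such that the following holds. Let $A\in L^\infty_{\mathrm{per}}(Y;\mathbb R^{n\times n}_{\mathrm{sym}})$ and $b\in L^\infty_{\mathrm{per}}(Y;\mathbb R^n)$ satisfy, a.e. in $\mathbb R^n$, $$\lambda I_n\le A\le \Lambda I_n,\qquad \frac{|A|^2+|b|^2}{(\mathrm{tr}\,A)^2}\le\frac1{n-1+\delta},$$ where $|A|$ is the Frobenius norm. Set $\gamma:=\frac{\mathrm{tr}\,A}{|A|^2+|b|^2}$, $\tilde A:=\gamma A$, $\tilde b:=\gamma b$. Let $r\in L^2_{\mathrm{per}}(Y)$ be the invariant measure, i.e. the solution of $-D^2:(Ar)+\nabla\cdot(br)=0$ with $\int_Y r=1$ in the very weak sense $$\int_Y r\,\big(A:D^2\varphi+b\cdot\nabla\varphi\big)=0\qquad\forall\varphi\in H^2_{\mathrm{per}}(Y),$$ and assume the centering condition $\int_Y r\,b=0$.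 Let the subscript $0$ denote the subspace of functions with mean zero over $Y$, and write $$B_1(\varphi_1,\varphi_2):=\int_Y\Delta\varphi_1\,\big(\tilde A:D^2\varphi_2+\tilde b\cdot\nabla\varphi_2\big),\qquad \varphi_1,\varphi_2\in H^2_{\mathrm{per},0}(Y),$$ $$B_2(v,w):=\int_Y(\nabla\cdot v)\big(\tilde A:Dw+\tilde b\cdot w\big)+\frac12\int_Y\big(Dv-(Dv)^{\mathrm T}\big):\big(Dw-(Dw)^{\mathrm T}\big),\qquad v,w\in H^1_{\mathrm{per},0}(Y;\mathbb R^n).$$ Then for every $j\in\{1,\dots,n\}$: (i) There is a unique $\chi_j\in H^2_{\mathrm{per},0}(Y)$ such that $B_1(\varphi,\chi_j)=-\int_Y\tilde b_j\,\Delta\varphi$ for all $\varphi\in H^2_{\mathrm{per},0}(Y)$. Further, $\chi_j$ is the unique function in $H^2_{\mathrm{per},0}(Y)$ satisfying $-A:D^2\chi_j-b\cdot\nabla\chi_j=b_j$ a.e. in $Y$. (ii) $\nabla\chi_j$ is the unique $\xi_j\in H^1_{\mathrm{per},0}(Y;\mathbb R^n)$ such that $B_2(w,\xi_j)=-\int_Y\tilde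 b_j\,\nabla\cdot w$ for all $w\in H^1_{\mathrm{per},0}(Y;\mathbb R^n)$. Further, for every closed linear subspace $P_h$ of $H^1_{\mathrm{per},0}(Y;\mathbb R^n)$ there is a unique $\xi_{j,h}\in P_h$ such that $B_2(w_h,\xi_{j,h})=-\int_Y\tilde b_j\,\nabla\cdot w_h$ for all $w_h\in P_h$, and $$\|\nabla\chi_j-\xi_{j,h}\|_{H^1(Y;\mathbb R^n)}\le C\inf_{w_h\in P_h}\|D(\nabla\chi_j-w_h)\|_{L^2(Y;\mathbb R^{n\times n})}.$$ -/

import Mathlib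

open MeasureTheory Filter Topology
open scoped ContDiff Matrix

noncomputable section

namespace PeriodicCorrector

/-- The unit cell `Y = (0,1)^n`. -/
def unitCell (n : ℕ) : Set (Fin n → ℝ) :=
  Set.pi Set.univ fun _ => Set.Ioo 0 1

/-- `L²_per(Y)`: a `Y`-periodic function is determined by its restriction to `Y`, and every
`L²` function on `Y` has a unique periodic extension, so the space is the real `L²(Y)`. -/
abbrev L2per (n : ℕ) : Type :=
  Lp ℝ 2 ((volume : Measure (Fin n → ℝ)).restrict (unitCell n))

/-- Smooth `Y`-periodic functions on `ℝⁿ`, the space `C^∞_per(Y)`. -/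
def IsSmoothPeriodic {n : ℕ} (φ : (Fin n → ℝ) → ℝ) : Prop :=
  ContDiff ℝ ∞ φ ∧ ∀ (i : Fin n) (x : Fin n → ℝ), φ (x + Pi.single i 1) = φ x

/-- `g` is the weak derivative `∂ᵢu` of the periodic function `u`:
`∫_Y u ∂ᵢφ = - ∫_Y g φ` for all smooth periodic `φ`. Testing with periodic functions (not only
with functions supported in `Y`) says that the weak derivative of the periodic extension of `u`
to `ℝⁿ` is the periodic extension of `g`. -/
def IsWeakPartial {n : ℕ} (i : Fin n) (u g : L2per n) : Prop :=
  ∀ φ : (Fin n → ℝ) → ℝ, IsSmoothPeriodic φ →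
    ∫ y in unitCell n, u y * fderiv ℝ φ y (Pi.single i 1) = - ∫ y in unitCell n, g y * φ y

open Classical in
/-- The weak derivative `∂ᵢu` in `L²_per(Y)` (and `0` if there is none; it is only used where
it exists). -/
def weakPartial {n : ℕ} (i : Fin n) (u : L2per n) : L2per n :=
  if h : ∃ g, IsWeakPartial i u g then h.choose else 0

/-- `H¹_per(Y)`. -/
def H1per (n : ℕ) : Set (L2per n) :=
  {u | ∀ i, ∃ g, IsWeakPartial i u g}

/-- `H²_per(Y)`. -/
def H2per (n : ℕ) : Set (L2per n) :=
  {u | u ∈ H1per n ∧ ∀ i, weakPartial i u ∈ H1per n}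

/-- `H²_{per,0}(Y)`: functions in `H²_per(Y)` with mean zero. -/
def H2per0 (n : ℕ) : Set (L2per n) :=
  {u | u ∈ H2per n ∧ ∫ y in unitCell n, u y = 0}

/-- `H¹_{per,0}(Y;ℝⁿ)`: vector fields with components in `H¹_per(Y)` of mean zero. -/
def H1per0Vec (n : ℕ) : Set (Fin n → L2per n) :=
  {w | ∀ i, w i ∈ H1per n ∧ ∫ y in unitCell n, w i y = 0}

/-- The gradient `∇u`. -/
def grad {n : ℕ} (u : L2per n) : Fin n → L2per n := fun i => weakPartial i u

/-- The Jacobian `Dw`, with entries `(Dw)ᵢⱼ = ∂ⱼwᵢ`. -/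
def jac {n : ℕ} (w : Fin n → L2per n) (i j : Fin n) : L2per n := weakPartial j (w i)

/-- The divergence `∇·w`. -/
def divg {n : ℕ} (w : Fin n → L2per n) : L2per n := ∑ i, weakPartial i (w i)

/-- The Laplacian `Δu`. -/
def lapl {n : ℕ} (u : L2per n) : L2per n := ∑ i, weakPartial i (weakPartial i u)

/-- `‖Dw‖_{L²(Y;ℝ^{n×n})}`. -/
def jacNorm {n : ℕ} (w : Fin n → L2per n) : ℝ :=
  Real.sqrt (∑ i, ∑ j, ‖jac w i j‖ ^ 2)

/-- `‖w‖_{H¹(Y;ℝⁿ)}`. -/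
def h1Norm {n : ℕ} (w : Fin n → L2per n) : ℝ :=
  Real.sqrt (∑ i, ‖w i‖ ^ 2 + ∑ i, ∑ j, ‖jac w i j‖ ^ 2)

/-- `P` is a closed linear subspace of `H¹_{per,0}(Y;ℝⁿ)`, closed for the `H¹` norm. -/
def IsClosedSubspace {n : ℕ} (P : Submodule ℝ (Fin n → L2per n)) : Prop :=
  (P : Set (Fin n → L2per n)) ⊆ H1per0Vec n ∧
  ∀ (w : ℕ → Fin n → L2per n) (v : Fin n → L2per n), (∀ k, w k ∈ P) → v ∈ H1per0Vec n →
    Tendsto (fun k => h1Norm (w k - v)) atTop (𝓝 0) → v ∈ P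

/-- `f ∈ L^∞_per(Y)`, as a periodic function on `ℝⁿ`. -/
def MemLinftyPer {n : ℕ} (f : (Fin n → ℝ) → ℝ) : Prop :=
  MemLp f ⊤ volume ∧ ∀ i : Fin n, ∀ᵐ x, f (x + Pi.single i 1) = f x

/-- `|A|² + |b|²` at a point, with the Frobenius norm of `A`. -/
def coeffSq {n : ℕ} (A : (Fin n → ℝ) → Matrix (Fin n) (Fin n) ℝ) (b : (Fin n → ℝ) → Fin n → ℝ)
    (x : Fin n → ℝ) : ℝ :=
  ∑ i, ∑ j, A x i j ^ 2 + ∑ i, b x i ^ 2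

/-- The pair `(A,b)` satisfies the Cordes-type setting with ellipticity constants
`lam ≤ Lam` and Cordes parameter `δ`. -/
structure CordesSetting {n : ℕ} (lam Lam δ : ℝ) (A : (Fin n → ℝ) → Matrix (Fin n) (Fin n) ℝ)
    (b : (Fin n → ℝ) → Fin n → ℝ) : Prop where
  A_bounded : ∀ i j, MemLinftyPer fun x => A x i j
  b_bounded : ∀ i, MemLinftyPer fun x => b x i
  A_symm : ∀ᵐ x, (A x).IsSymm
  elliptic : ∀ᵐ x, ∀ ξ : Fin n → ℝ,
    lam * (ξ ⬝ᵥ ξ) ≤ ξ ⬝ᵥ (A x *ᵥ ξ) ∧ ξ ⬝ᵥ (A x *ᵥ ξ) ≤ Lam * (ξ ⬝ᵥ ξ)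
  cordes : ∀ᵐ x, coeffSq A b x / (A x).trace ^ 2 ≤ 1 / ((n : ℝ) - 1 + δ)

/-- The renormalization function `γ = tr(A) / (|A|² + |b|²)`. -/
def renorm {n : ℕ} (A : (Fin n → ℝ) → Matrix (Fin n) (Fin n) ℝ) (b : (Fin n → ℝ) → Fin n → ℝ)
    (x : Fin n → ℝ) : ℝ :=
  (A x).trace / coeffSq A b x

/-- `Ã = γA`. -/
def renormA {n : ℕ} (A : (Fin n → ℝ) → Matrix (Fin n) (Fin n) ℝ) (b : (Fin n → ℝ) → Fin n → ℝ)
    (x : Fin n → ℝ) : Matrix (Fin n) (Fin n) ℝ :=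
  renorm A b x • A x

/-- `b̃ = γb`. -/
def renormb {n : ℕ} (A : (Fin n → ℝ) → Matrix (Fin n) (Fin n) ℝ) (b : (Fin n → ℝ) → Fin n → ℝ)
    (x : Fin n → ℝ) : Fin n → ℝ :=
  renorm A b x • b x

/-- The function `A : Dw + b · w`. -/
def firstOrderOp {n : ℕ} (A : (Fin n → ℝ) → Matrix (Fin n) (Fin n) ℝ)
    (b : (Fin n → ℝ) → Fin n → ℝ) (w : Fin n → L2per n) (x : Fin n → ℝ) : ℝ :=
  ∑ i, ∑ j, A x i j * jac w i j x + ∑ i, b x i * w i x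

/-- The function `A : D²u + b · ∇u`. -/
def secondOrderOp {n : ℕ} (A : (Fin n → ℝ) → Matrix (Fin n) (Fin n) ℝ)
    (b : (Fin n → ℝ) → Fin n → ℝ) (u : L2per n) (x : Fin n → ℝ) : ℝ :=
  ∑ i, ∑ j, A x i j * weakPartial i (weakPartial j u) x + ∑ i, b x i * weakPartial i u x

/-- `r ∈ L²_per(Y)` is the invariant measure: the very weak periodic solution of
`-D²:(Ar) + ∇·(br) = 0` with `∫_Y r = 1`. -/
def IsInvariantMeasure {n : ℕ} (A : (Fin n → ℝ) → Matrix (Fin n) (Fin n) ℝ)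
    (b : (Fin n → ℝ) → Fin n → ℝ) (r : L2per n) : Prop :=
  (∀ φ ∈ H2per n, ∫ y in unitCell n, r y * secondOrderOp A b φ y = 0) ∧
  ∫ y in unitCell n, r y = 1

/-- `B₁(φ₁,φ₂) = ∫_Y Δφ₁ (Ã:D²φ₂ + b̃·∇φ₂)`. -/
def B1 {n : ℕ} (A : (Fin n → ℝ) → Matrix (Fin n) (Fin n) ℝ)
    (b : (Fin n → ℝ) → Fin n → ℝ) (φ₁ φ₂ : L2per n) : ℝ :=
  ∫ y in unitCell n, lapl φ₁ y * secondOrderOp (renormA A b) (renormb A b) φ₂ y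

/-- `B₂(v,w) = ∫_Y (∇·v)(Ã:Dw + b̃·w) + ½ ∫_Y (Dv - (Dv)ᵀ):(Dw - (Dw)ᵀ)`. -/
def B2 {n : ℕ} (A : (Fin n → ℝ) → Matrix (Fin n) (Fin n) ℝ)
    (b : (Fin n → ℝ) → Fin n → ℝ) (v w : Fin n → L2per n) : ℝ :=
  (∫ y in unitCell n, divg v y * firstOrderOp (renormA A b) (renormb A b) w y) +
  (1 / 2) * ∫ y in unitCell n,
    ∑ i, ∑ j, (jac v i j y - jac v j i y) * (jac w i j y - jac w j i y)

/-- `-A:D²χ - b·∇χ = bⱼ` almost everywhere in `Y`. (Periodicity and the zero mean are part of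
membership in `H²_{per,0}(Y)`.) -/
def SolvesCorrector {n : ℕ} (A : (Fin n → ℝ) → Matrix (Fin n) (Fin n) ℝ)
    (b : (Fin n → ℝ) → Fin n → ℝ) (j : Fin n) (χ : L2per n) : Prop :=
  ∀ᵐ y ∂((volume : Measure (Fin n → ℝ)).restrict (unitCell n)),
    -secondOrderOp A b χ y = b y j

/-- `B₁(φ,χ) = -∫_Y b̃ⱼ Δφ` for all `φ ∈ H²_{per,0}(Y)`. -/
def SolvesB1 {n : ℕ} (A : (Fin n → ℝ) → Matrix (Fin n) (Fin n) ℝ)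
    (b : (Fin n → ℝ) → Fin n → ℝ) (j : Fin n) (χ : L2per n) : Prop :=
  ∀ φ ∈ H2per0 n, B1 A b φ χ = - ∫ y in unitCell n, renormb A b y j * lapl φ y

/-- `B₂(w,ξ) = -∫_Y b̃ⱼ ∇·w` for all `w` in the set `S` of test fields. -/
def SolvesB2 {n : ℕ} (A : (Fin n → ℝ) → Matrix (Fin n) (Fin n) ℝ)
    (b : (Fin n → ℝ) → Fin n → ℝ) (j : Fin n) (S : Set (Fin n → L2per n))
    (ξ : Fin n → L2per n) : Prop :=
  ∀ w ∈ S, B2 A b w ξ = - ∫ y in unitCell n, renormb A b y j * divg w y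

end PeriodicCorrector

end

noncomputable section

namespace PeriodicCorrector

open UnitAddTorus
open scoped ComplexConjugate

/-- The Haar probability measure on the circle, as in Mathlib's file on multivariate Fourier
series. -/
local instance circleMeasureSpace : MeasureSpace UnitAddCircle := ⟨AddCircle.haarAddCircle⟩

local instance : IsProbabilityMeasure (volume : Measure UnitAddCircle) :=
  inferInstanceAs (IsProbabilityMeasure AddCircle.haarAddCircle)

/-- Lebesgue measure on the unit cell. -/
abbrev cellMeasure (n : ℕ) : Measure (Fin n → ℝ) := volume.restrict (unitCell n)

/-- The complex space `L²(Y;ℂ)`. -/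
abbrev L2cx (n : ℕ) : Type := Lp ℂ 2 (cellMeasure n)

/-- The character `x ↦ exp(2πi k·x)`. -/
def expChar {n : ℕ} (k : Fin n → ℤ) (x : Fin n → ℝ) : ℂ :=
  mFourier k fun i => (x i : UnitAddCircle)

/-- The section of `ℝⁿ → ℝⁿ/ℤⁿ` with values in `(0,1]ⁿ`. -/
def cellSection (n : ℕ) (x : UnitAddTorus (Fin n)) : Fin n → ℝ :=
  (measurableEquivPiIoc (0 : Fin n → ℝ) x).1

lemma volume_unitCell (n : ℕ) : volume (unitCell n) = 1 := by
  simp [unitCell, Real.volume_pi_Ioo]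

instance (n : ℕ) : IsProbabilityMeasure (cellMeasure n) :=
  ⟨by simp [volume_unitCell]⟩

lemma cellMeasure_eq_Ioc (n : ℕ) : cellMeasure n =
    volume.restrict {x : Fin n → ℝ | ∀ i, x i ∈ Set.Ioc ((0 : Fin n → ℝ) i) ((0 : Fin n → ℝ) i + 1)} := by
  have : {x : Fin n → ℝ | ∀ i, x i ∈ Set.Ioc ((0 : Fin n → ℝ) i) ((0 : Fin n → ℝ) i + 1)} =
      Set.pi Set.univ fun _ => Set.Ioc 0 1 := by
    ext x; simp
  rw [this]
  exact Measure.restrict_congr_set Measure.pi_Ioo_ae_eq_pi_Ioc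

lemma measurePreserving_cellSection (n : ℕ) :
    MeasurePreserving (cellSection n) volume (cellMeasure n) := by
  have h := measurePreserving_equivPiIoc (0 : Fin n → ℝ)
  have hs : MeasurableSet
      {x : Fin n → ℝ | ∀ i, x i ∈ Set.Ioc ((0 : Fin n → ℝ) i) ((0 : Fin n → ℝ) i + 1)} :=
    MeasurableSet.univ_pi' fun i => measurableSet_Ioc
  have h2 := measurePreserving_subtype_coe (μa := (volume : Measure (Fin n → ℝ))) hs
  rw [← cellMeasure_eq_Ioc] at h2
  exact h2.comp h

lemma expChar_cellSection {n : ℕ} (k : Fin n → ℤ) (x : UnitAddTorus (Fin n)) :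
    expChar k (cellSection n x) = mFourier k x := by
  have : (fun i => ((cellSection n x i : ℝ) : UnitAddCircle)) = x :=
    (measurableEquivPiIoc (0 : Fin n → ℝ)).symm_apply_apply x
  rw [expChar, this]

lemma expChar_apply {n : ℕ} (k : Fin n → ℤ) (x : Fin n → ℝ) :
    expChar k x = Complex.exp (2 * Real.pi * Complex.I * ∑ i, (k i : ℂ) * (x i : ℂ)) := by
  rw [Finset.mul_sum, Complex.exp_sum]
  simp only [expChar, mFourier, ContinuousMap.coe_mk, fourier_coe_apply]
  refine Finset.prod_congr rfl fun i _ => ?_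
  congr 1
  push_cast
  ring

lemma expChar_neg {n : ℕ} (k : Fin n → ℤ) (x : Fin n → ℝ) :
    expChar (-k) x = conj (expChar k x) := mFourier_neg

lemma expChar_zero {n : ℕ} (x : Fin n → ℝ) : expChar 0 x = 1 := by
  simp [expChar, mFourier_zero]

lemma contDiff_expChar {n : ℕ} (k : Fin n → ℤ) : ContDiff ℝ ∞ (expChar k) := by
  have : expChar k = fun x : Fin n → ℝ =>
      Complex.exp (2 * Real.pi * Complex.I * ∑ i, (k i : ℂ) * Complex.ofRealCLM (x i)) :=
    funext fun x => expChar_apply k x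
  rw [this]
  fun_prop

lemma norm_expChar {n : ℕ} (k : Fin n → ℤ) (x : Fin n → ℝ) : ‖expChar k x‖ = 1 := by
  simp only [expChar, mFourier, fourier_apply, ContinuousMap.coe_mk, norm_prod, Circle.norm_coe,
    Finset.prod_const_one]

lemma memLp_expChar {n : ℕ} (k : Fin n → ℤ) : MemLp (expChar k) 2 (cellMeasure n) :=
  MemLp.of_bound (contDiff_expChar k).continuous.aestronglyMeasurable 1
    (ae_of_all _ fun x => (norm_expChar k x).le)

/-- The character `exp(2πi k·x)` as an element of `L²(Y;ℂ)`. -/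
def expLp {n : ℕ} (k : Fin n → ℤ) : L2cx n := (memLp_expChar k).toLp _

/-- Pull-back along `cellSection`. -/
def toTorus (n : ℕ) : L2cx n →ₗᵢ[ℂ] Lp ℂ 2 (volume : Measure (UnitAddTorus (Fin n))) :=
  Lp.compMeasurePreservingₗᵢ ℂ (cellSection n) (measurePreserving_cellSection n)

lemma toTorus_expLp {n : ℕ} (k : Fin n → ℤ) : toTorus n (expLp k) = mFourierLp 2 k := by
  refine Lp.ext ?_
  have h1 := Lp.coeFn_compMeasurePreserving (expLp k) (measurePreserving_cellSection n)
  have h2 := (measurePreserving_cellSection n).quasiMeasurePreserving.ae_eq_comp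
    (memLp_expChar k).coeFn_toLp
  refine h1.trans (h2.trans (EventuallyEq.trans ?_ (coeFn_mFourierLp 2 k).symm))
  exact ae_of_all _ fun x => expChar_cellSection k x

lemma orthonormal_expLp (n : ℕ) : Orthonormal ℂ (expLp (n := n)) := by
  have h := orthonormal_mFourier (d := Fin n)
  have h2 : (mFourierLp (d := Fin n) 2) = toTorus n ∘ expLp := funext fun k => (toTorus_expLp k).symm
  rw [h2] at h
  exact (LinearIsometry.orthonormal_comp_iff (toTorus n)).1 h

/-- The Fourier basis of `L²(Y;ℂ)`. -/
def cellBasis (n : ℕ) : HilbertBasis (Fin n → ℤ) ℂ (L2cx n) :=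
  HilbertBasis.mkOfOrthogonalEqBot (orthonormal_expLp n) <| by
    rw [Submodule.eq_bot_iff]
    intro f hf
    have h0 : ∀ k, mFourierBasis.repr (toTorus n f) k = 0 := by
      intro k
      rw [HilbertBasis.repr_apply_apply, coe_mFourierBasis, ← toTorus_expLp,
        LinearIsometry.inner_map_map]
      exact Submodule.mem_orthogonal _ _ |>.1 hf _ (Submodule.subset_span ⟨k, rfl⟩)
    have h1 : mFourierBasis.repr (toTorus n f) = 0 := by
      ext k
      exact h0 k
    have h2 : toTorus n f = 0 := by simpa using h1
    exact (toTorus n).injective (h2.trans (map_zero _).symm)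

lemma coe_cellBasis (n : ℕ) : ⇑(cellBasis n) = expLp :=
  HilbertBasis.coe_mkOfOrthogonalEqBot _ _

lemma cellBasis_repr {n : ℕ} (f : L2cx n) (k : Fin n → ℤ) :
    (cellBasis n).repr f k = ∫ x in unitCell n, expChar (-k) x * f x := by
  rw [HilbertBasis.repr_apply_apply, coe_cellBasis, L2.inner_def]
  refine integral_congr_ae ?_
  filter_upwards [(memLp_expChar k).coeFn_toLp] with x hx
  rw [expLp, hx, RCLike.inner_apply, expChar_neg, mul_comm]

variable {n : ℕ}

/-! ### Fourier coefficients of real functions -/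

/-- The inclusion of `L²(Y)` in `L²(Y;ℂ)`. -/
def ofRealLp (n : ℕ) : L2per n →L[ℝ] L2cx n := Complex.ofRealCLM.compLpL 2 (cellMeasure n)

lemma coeFn_ofRealLp (u : L2per n) : ofRealLp n u =ᵐ[cellMeasure n] fun x => (u x : ℂ) :=
  Complex.ofRealCLM.coeFn_compLpL u

/-- The Fourier coefficients of a real periodic function. -/
def fc (u : L2per n) (k : Fin n → ℤ) : ℂ := (cellBasis n).repr (ofRealLp n u) k

lemma fc_eq_integral (u : L2per n) (k : Fin n → ℤ) :
    fc u k = ∫ x in unitCell n, expChar (-k) x * (u x : ℂ) := by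
  rw [fc, cellBasis_repr]
  refine integral_congr_ae ?_
  filter_upwards [coeFn_ofRealLp u] with x hx
  rw [hx]

lemma fc_add (u v : L2per n) (k : Fin n → ℤ) : fc (u + v) k = fc u k + fc v k := by
  simp [fc]

lemma fc_sub (u v : L2per n) (k : Fin n → ℤ) : fc (u - v) k = fc u k - fc v k := by
  simp [fc]

lemma fc_smul (c : ℝ) (u : L2per n) (k : Fin n → ℤ) : fc (c • u) k = c * fc u k := by
  have : ofRealLp n (c • u) = (c : ℂ) • ofRealLp n u := by
    rw [map_smul]
    rfl
  rw [fc, this, map_smul]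
  rfl

lemma fc_zero (k : Fin n → ℤ) : fc (0 : L2per n) k = 0 := by
  simp [fc]

lemma fc_sum {ι : Type*} (s : Finset ι) (u : ι → L2per n) (k : Fin n → ℤ) :
    fc (∑ i ∈ s, u i) k = ∑ i ∈ s, fc (u i) k := by
  classical
  induction s using Finset.induction_on with
  | empty => simp [fc_zero]
  | insert i s hi ih => rw [Finset.sum_insert hi, Finset.sum_insert hi, fc_add, ih]

lemma fc_neg_index (u : L2per n) (k : Fin n → ℤ) : fc u (-k) = conj (fc u k) := by
  rw [fc_eq_integral, fc_eq_integral, ← integral_conj]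
  refine integral_congr_ae (ae_of_all _ fun x => ?_)
  simp [expChar_neg]

lemma inner_ofRealLp (u v : L2per n) :
    inner ℂ (ofRealLp n u) (ofRealLp n v) = ((inner ℝ u v : ℝ) : ℂ) := by
  rw [L2.inner_def, L2.inner_def, ← integral_complex_ofReal]
  refine integral_congr_ae ?_
  filter_upwards [coeFn_ofRealLp u, coeFn_ofRealLp v] with x hu hv
  rw [hu, hv]
  simp

/-- Parseval's identity. -/
lemma hasSum_fc (u v : L2per n) :
    HasSum (fun k => conj (fc u k) * fc v k) ((inner ℝ u v : ℝ) : ℂ) := by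
  rw [← inner_ofRealLp]
  refine ((cellBasis n).hasSum_inner_mul_inner _ _).congr_fun fun k => ?_
  rw [fc, fc, HilbertBasis.repr_apply_apply, HilbertBasis.repr_apply_apply, inner_conj_symm]

lemma hasSum_norm_fc (u : L2per n) : HasSum (fun k => ‖fc u k‖ ^ 2) (‖u‖ ^ 2) := by
  have h := hasSum_fc u u
  rw [real_inner_self_eq_norm_sq] at h
  have h2 : (fun k => conj (fc u k) * fc u k) = fun k => ((‖fc u k‖ ^ 2 : ℝ) : ℂ) := by
    funext k
    rw [Complex.conj_mul']
    push_cast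
    rfl
  rw [h2] at h
  exact_mod_cast h

lemma fc_injective {u v : L2per n} (h : ∀ k, fc u k = fc v k) : u = v := by
  have h1 := hasSum_norm_fc (u - v)
  have h2 : (fun k => ‖fc (u - v) k‖ ^ 2) = fun _ => 0 := by
    funext k
    simp [fc_sub, h k]
  rw [h2] at h1
  have h3 := h1.unique hasSum_zero
  exact sub_eq_zero.1 (norm_eq_zero.1 (pow_eq_zero_iff (two_ne_zero) |>.1 h3))

lemma integral_eq_fc_zero (u : L2per n) : ((∫ y in unitCell n, u y : ℝ) : ℂ) = fc u 0 := by
  rw [fc_eq_integral, ← integral_complex_ofReal]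
  simp [expChar_zero]

lemma integral_eq_zero_iff_fc (u : L2per n) : ∫ y in unitCell n, u y = 0 ↔ fc u 0 = 0 := by
  rw [← integral_eq_fc_zero]
  exact Complex.ofReal_eq_zero.symm

lemma integral_mul_eq_inner (u v : L2per n) : ∫ y in unitCell n, u y * v y = inner ℝ u v := by
  rw [L2.inner_def]
  refine integral_congr_ae (ae_of_all _ fun x => ?_)
  simp [mul_comm]

/-- Bounded Fourier multipliers with Hermitian symbol act on real functions. -/
lemma exists_fc_eq_mul (m : (Fin n → ℤ) → ℂ) (C : ℝ) (hC : ∀ k, ‖m k‖ ≤ C)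
    (hm : ∀ k, m (-k) = conj (m k)) (f : L2per n) :
    ∃ u : L2per n, ∀ k, fc u k = m k * fc f k := by
  have hmem : Memℓp (fun k => m k * fc f k) 2 := by
    refine memℓp_gen ?_
    have h := (hasSum_norm_fc f).summable.mul_left (C ^ 2)
    refine Summable.of_nonneg_of_le (fun k => by positivity) (fun k => ?_) h
    simp only [ENNReal.toReal_ofNat, Real.rpow_ofNat, norm_mul, mul_pow]
    gcongr
    exact hC k
  set U : L2cx n := (cellBasis n).repr.symm ⟨_, hmem⟩ with hU
  have hUk : ∀ k, ∫ x in unitCell n, expChar (-k) x * U x = m k * fc f k := by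
    intro k
    rw [← cellBasis_repr, hU, LinearIsometryEquiv.apply_symm_apply]
  have hint : ∀ k, Integrable (fun x => expChar k x * U x) (cellMeasure n) := by
    intro k
    refine ((Lp.memLp U).integrable (by norm_num)).bdd_mul
      (contDiff_expChar k).continuous.aestronglyMeasurable
      (ae_of_all _ fun x => (norm_expChar k x).le)
  refine ⟨Complex.reCLM.compLpL 2 (cellMeasure n) U, fun k => ?_⟩
  have hre := Complex.reCLM.coeFn_compLpL (p := 2) (μ := cellMeasure n) U
  rw [fc_eq_integral]
  have h1 : ∫ x in unitCell n, expChar (-k) x *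
      ((Complex.reCLM.compLpL 2 (cellMeasure n) U x : ℝ) : ℂ) =
      ∫ x in unitCell n, (1 / 2 : ℂ) *
        (expChar (-k) x * U x + conj (expChar (- -k) x * U x)) := by
    refine integral_congr_ae ?_
    filter_upwards [hre] with x hx
    rw [hx, expChar_neg (-k), map_mul, Complex.conj_conj, Complex.reCLM_apply,
      Complex.re_eq_add_conj]
    ring
  rw [h1, integral_const_mul, integral_add (hint _) (by
    simpa using Complex.conjCLE.toContinuousLinearMap.integrable_comp (hint (- -k))),
    integral_conj, hUk, hUk, hm, fc_neg_index, map_mul, Complex.conj_conj, Complex.conj_conj]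
  ring

/-! ### Smooth periodic functions -/

lemma unitCell_subset_Icc : unitCell n ⊆ Set.Icc 0 1 := by
  intro x hx
  exact ⟨fun i => (hx i trivial).1.le, fun i => (hx i trivial).2.le⟩

lemma measurableSet_unitCell : MeasurableSet (unitCell n) :=
  MeasurableSet.univ_pi fun _ => measurableSet_Ioo

lemma integral_unitCell_eq_Icc (f : (Fin n → ℝ) → ℝ) :
    ∫ y in unitCell n, f y = ∫ y in Set.Icc 0 1, f y := by
  rw [Measure.restrict_congr_set (μ := (volume : Measure (Fin n → ℝ)))]
  exact Measure.univ_pi_Ioo_ae_eq_Icc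

lemma memLp_of_continuous {f : (Fin n → ℝ) → ℝ} (hf : Continuous f) :
    MemLp f 2 (cellMeasure n) := by
  obtain ⟨C, hC⟩ := (isCompact_Icc (a := (0 : Fin n → ℝ)) (b := 1)).exists_bound_of_continuousOn
    hf.continuousOn
  refine MemLp.of_bound hf.aestronglyMeasurable C ?_
  exact ae_restrict_of_forall_mem measurableSet_unitCell
    fun x hx => hC x (unitCell_subset_Icc hx)

lemma IsSmoothPeriodic.mul {φ ψ : (Fin n → ℝ) → ℝ} (hφ : IsSmoothPeriodic φ)
    (hψ : IsSmoothPeriodic ψ) : IsSmoothPeriodic fun x => φ x * ψ x :=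
  ⟨hφ.1.mul hψ.1, fun i x => by simp only [hφ.2, hψ.2]⟩

lemma IsSmoothPeriodic.continuous_fderiv_apply {φ : (Fin n → ℝ) → ℝ} (hφ : IsSmoothPeriodic φ)
    (v : Fin n → ℝ) : Continuous fun x => fderiv ℝ φ x v :=
  (hφ.1.continuous_fderiv (by simp)).clm_apply continuous_const

/-- Partial derivatives of smooth periodic functions have mean zero. -/
lemma IsSmoothPeriodic.integral_fderiv {φ : (Fin n → ℝ) → ℝ} (hφ : IsSmoothPeriodic φ)
    (i : Fin n) : ∫ y in unitCell n, fderiv ℝ φ y (Pi.single i 1) = 0 := by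
  cases n with
  | zero => exact i.elim0
  | succ m =>
    have hcont := hφ.continuous_fderiv_apply (Pi.single i 1)
    have hd : ∀ x, HasFDerivAt φ (fderiv ℝ φ x) x := fun x =>
      (hφ.1.differentiable (by simp) x).hasFDerivAt
    have key := integral_divergence_of_hasFDerivAt_off_countable' (0 : Fin (m + 1) → ℝ) 1
      (fun _ => zero_le_one) (fun j => if j = i then φ else 0)
      (fun j x => if j = i then fderiv ℝ φ x else 0) ∅ Set.countable_empty
      (fun j => by
        split_ifs
        · exact hφ.1.continuous.continuousOn
        · exact continuousOn_const)
      (fun x _ j => by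
        split_ifs
        · exact hd x
        · exact hasFDerivAt_const _ _)
      (by
        refine Continuous.integrableOn_Icc ?_
        refine continuous_finsetSum _ fun j _ => ?_
        split_ifs with h
        · rw [h]; exact hcont
        · exact continuous_const)
    have hsum : ∀ x, ∑ j, (if j = i then fderiv ℝ φ x else 0) (Pi.single j 1) =
        fderiv ℝ φ x (Pi.single i 1) := by
      intro x
      rw [Finset.sum_eq_single i]
      · simp
      · intro j _ hj; simp [hj]
      · simp
    simp only [hsum] at key
    rw [integral_unitCell_eq_Icc, key]
    refine Finset.sum_eq_zero fun j _ => ?_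
    rw [sub_eq_zero]
    refine integral_congr_ae (ae_of_all _ fun x => ?_)
    by_cases hj : j = i
    · subst hj
      have h1 : j.insertNth ((1 : Fin (m + 1) → ℝ) j) x =
          j.insertNth ((0 : Fin (m + 1) → ℝ) j) x + (Pi.single j 1 : Fin (m + 1) → ℝ) := by
        funext l
        rcases eq_or_ne l j with rfl | h
        · simp
        · obtain ⟨l', rfl⟩ := Fin.exists_succAbove_eq h
          simp
      simp only [if_true]
      rw [h1, hφ.2]
    · simp [hj]

/-- Smooth periodic functions are weakly differentiable. -/
lemma IsSmoothPeriodic.isWeakPartial {φ : (Fin n → ℝ) → ℝ} (hφ : IsSmoothPeriodic φ) (i : Fin n) :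
    IsWeakPartial i ((memLp_of_continuous hφ.1.continuous).toLp φ)
      ((memLp_of_continuous (hφ.continuous_fderiv_apply (Pi.single i 1))).toLp _) := by
  intro ψ hψ
  have h := (hφ.mul hψ).integral_fderiv i
  have hd : ∀ x, fderiv ℝ (fun x => φ x * ψ x) x (Pi.single i 1) =
      φ x * fderiv ℝ ψ x (Pi.single i 1) + fderiv ℝ φ x (Pi.single i 1) * ψ x := by
    intro x
    rw [fderiv_fun_mul (hφ.1.differentiable (by simp) x) (hψ.1.differentiable (by simp) x)]
    simp
    ring
  simp only [hd] at h
  have hi : ∀ {f g : (Fin n → ℝ) → ℝ}, Continuous f → Continuous g →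
      Integrable (fun x => f x * g x) (cellMeasure n) := fun hf hg =>
    (memLp_of_continuous (hf.mul hg)).integrable (by norm_num)
  rw [integral_add (hi hφ.1.continuous (hψ.continuous_fderiv_apply _))
    (hi (hφ.continuous_fderiv_apply _) hψ.1.continuous)] at h
  rw [eq_neg_iff_add_eq_zero, ← h]
  congr 1
  · refine integral_congr_ae ?_
    filter_upwards [(memLp_of_continuous hφ.1.continuous).coeFn_toLp] with x hx
    rw [hx]
  · refine integral_congr_ae ?_
    filter_upwards [(memLp_of_continuous (hφ.continuous_fderiv_apply (Pi.single i 1))).coeFn_toLp]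
      with x hx
    rw [hx]

/-! ### Weak derivatives in terms of Fourier coefficients -/

/-- The Fourier symbol `2πi kᵢ` of `∂ᵢ`. -/
def derivSymbol (i : Fin n) (k : Fin n → ℤ) : ℂ := 2 * Real.pi * Complex.I * k i

lemma fderiv_expChar (k : Fin n → ℤ) (x : Fin n → ℝ) (i : Fin n) :
    fderiv ℝ (expChar k) x (Pi.single i 1) = derivSymbol i k * expChar k x := by
  have h : HasFDerivAt (fun x : Fin n → ℝ => 2 * Real.pi * Complex.I *
      ∑ j, (k j : ℂ) * Complex.ofRealCLM (x j)) ((2 * Real.pi * Complex.I : ℂ) •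
      ∑ j, (k j : ℂ) • (Complex.ofRealCLM ∘L
        ContinuousLinearMap.proj (R := ℝ) (φ := fun _ : Fin n => ℝ) j)) x := by
    refine HasFDerivAt.const_mul (HasFDerivAt.fun_sum fun j _ => HasFDerivAt.const_mul ?_ _) _
    exact (Complex.ofRealCLM ∘L
      ContinuousLinearMap.proj (R := ℝ) (φ := fun _ : Fin n => ℝ) j).hasFDerivAt
  have h2 : expChar k = fun x : Fin n → ℝ => Complex.exp (2 * Real.pi * Complex.I *
      ∑ j, (k j : ℂ) * Complex.ofRealCLM (x j)) := funext fun x => expChar_apply k x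
  have h3 := h.cexp
  rw [← h2] at h3
  rw [h3.fderiv, congrFun h2 x]
  have h5 : ∑ j, (k j : ℂ) * ((Pi.single i 1 : Fin n → ℝ) j : ℂ) = k i := by
    rw [Finset.sum_eq_single i]
    · simp
    · intro j _ hj; simp [hj]
    · simp
  simp only [FunLike.coe_smul, Pi.smul_apply, FunLike.coe_sum, Finset.sum_apply,
    ContinuousLinearMap.comp_apply, ContinuousLinearMap.proj_apply, Complex.ofRealCLM_apply,
    smul_eq_mul, h5, derivSymbol]
  ring

lemma expChar_periodic (k : Fin n → ℤ) (i : Fin n) (x : Fin n → ℝ) :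
    expChar k (x + Pi.single i 1) = expChar k x := by
  unfold expChar
  congr 1
  funext j
  rcases eq_or_ne j i with rfl | h
  · simp
  · simp [h]

lemma isSmoothPeriodic_clm_expChar (L : ℂ →L[ℝ] ℝ) (k : Fin n → ℤ) :
    IsSmoothPeriodic fun x => L (expChar k x) :=
  ⟨L.contDiff.comp (contDiff_expChar k), fun i x => by simp only [expChar_periodic]⟩

lemma IsWeakPartial.fc_eq {i : Fin n} {u g : L2per n} (h : IsWeakPartial i u g) (k : Fin n → ℤ) :
    fc g k = derivSymbol i k * fc u k := by
  have hint : ∀ w : L2per n, Integrable (fun x => expChar (-k) x * (w x : ℂ)) (cellMeasure n) := by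
    intro w
    exact ((Lp.memLp w).integrable (by norm_num)).ofReal.bdd_mul
      (contDiff_expChar (-k)).continuous.aestronglyMeasurable
      (ae_of_all _ fun x => (norm_expChar (-k) x).le)
  have hs : derivSymbol i (-k) = -derivSymbol i k := by simp [derivSymbol]
  have key : ∀ L : ℂ →L[ℝ] ℝ, L (derivSymbol i k * fc u k) = L (fc g k) := by
    intro L
    have h1 := h _ (isSmoothPeriodic_clm_expChar L (-k))
    have h2 : ∀ x, fderiv ℝ (fun x => L (expChar (-k) x)) x (Pi.single i 1) =
        - L (derivSymbol i k * expChar (-k) x) := by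
      intro x
      have h3 := L.hasFDerivAt.comp x
        ((contDiff_expChar (-k)).differentiable (by simp) x).hasFDerivAt
      have h4 : fderiv ℝ (fun x => L (expChar (-k) x)) x = _ := h3.fderiv
      rw [h4, ContinuousLinearMap.comp_apply, fderiv_expChar, hs, neg_mul, map_neg]
    simp only [h2, mul_neg, integral_neg, neg_inj] at h1
    have hL : ∀ (r : ℝ) (z : ℂ), r * L z = L (z * r) := by
      intro r z
      rw [mul_comm z, ← Complex.real_smul, map_smul, smul_eq_mul]
    simp only [hL, mul_assoc] at h1
    rw [L.integral_comp_comm ((hint u).const_mul _), L.integral_comp_comm (hint g),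
      integral_const_mul] at h1
    rw [fc_eq_integral, fc_eq_integral, h1]
  refine Complex.ext ?_ ?_
  · exact (key Complex.reCLM).symm
  · exact (key Complex.imCLM).symm

lemma conj_derivSymbol (i : Fin n) (k : Fin n → ℤ) :
    conj (derivSymbol i k) = -derivSymbol i k := by
  rw [derivSymbol, map_mul, map_mul, map_mul, Complex.conj_I, Complex.conj_ofReal, map_intCast,
    map_ofNat]
  ring

lemma isWeakPartial_iff_fc {i : Fin n} {u g : L2per n} :
    IsWeakPartial i u g ↔ ∀ k, fc g k = derivSymbol i k * fc u k := by
  refine ⟨fun h => h.fc_eq, fun h φ hφ => ?_⟩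
  set Φ := (memLp_of_continuous hφ.1.continuous).toLp φ with hΦ
  set Φ' := (memLp_of_continuous (hφ.continuous_fderiv_apply (Pi.single i 1))).toLp _ with hΦ'
  have h1 : ∫ y in unitCell n, u y * fderiv ℝ φ y (Pi.single i 1) = inner ℝ u Φ' := by
    rw [← integral_mul_eq_inner]
    refine integral_congr_ae ?_
    filter_upwards [(memLp_of_continuous
      (hφ.continuous_fderiv_apply (Pi.single i 1))).coeFn_toLp] with x hx
    rw [hΦ', hx]
  have h2 : ∫ y in unitCell n, g y * φ y = inner ℝ g Φ := by
    rw [← integral_mul_eq_inner]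
    refine integral_congr_ae ?_
    filter_upwards [(memLp_of_continuous hφ.1.continuous).coeFn_toLp] with x hx
    rw [hΦ, hx]
  rw [h1, h2]
  have h3 := hasSum_fc u Φ'
  have h4 := (hasSum_fc g Φ).neg
  have h5 : (fun k => conj (fc u k) * fc Φ' k) = fun k => -(conj (fc g k) * fc Φ k) := by
    funext k
    rw [(hφ.isWeakPartial i).fc_eq, h k, map_mul, conj_derivSymbol]
    ring
  rw [h5] at h3
  exact_mod_cast h3.unique h4

/-! ### Periodic Sobolev spaces -/

lemma isWeakPartial_weakPartial {u : L2per n} (hu : u ∈ H1per n) (i : Fin n) :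
    IsWeakPartial i u (weakPartial i u) := by
  rw [weakPartial, dif_pos (hu i)]
  exact (hu i).choose_spec

lemma fc_weakPartial {u : L2per n} (hu : u ∈ H1per n) (i : Fin n) (k : Fin n → ℤ) :
    fc (weakPartial i u) k = derivSymbol i k * fc u k :=
  (isWeakPartial_weakPartial hu i).fc_eq k

lemma IsWeakPartial.weakPartial_eq {i : Fin n} {u g : L2per n} (h : IsWeakPartial i u g) :
    weakPartial i u = g := by
  have hex : ∃ g, IsWeakPartial i u g := ⟨g, h⟩
  rw [weakPartial, dif_pos hex]
  exact fc_injective fun k => by rw [hex.choose_spec.fc_eq, h.fc_eq]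

lemma IsWeakPartial.add {i : Fin n} {u v g h : L2per n} (hu : IsWeakPartial i u g)
    (hv : IsWeakPartial i v h) : IsWeakPartial i (u + v) (g + h) := by
  rw [isWeakPartial_iff_fc] at *
  intro k
  rw [fc_add, fc_add, hu, hv, mul_add]

lemma IsWeakPartial.smul {i : Fin n} {u g : L2per n} (c : ℝ) (hu : IsWeakPartial i u g) :
    IsWeakPartial i (c • u) (c • g) := by
  rw [isWeakPartial_iff_fc] at *
  intro k
  rw [fc_smul, fc_smul, hu]
  ring

lemma add_mem_H1per {u v : L2per n} (hu : u ∈ H1per n) (hv : v ∈ H1per n) : u + v ∈ H1per n :=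
  fun i => ⟨_, (isWeakPartial_weakPartial hu i).add (isWeakPartial_weakPartial hv i)⟩

lemma smul_mem_H1per (c : ℝ) {u : L2per n} (hu : u ∈ H1per n) : c • u ∈ H1per n :=
  fun i => ⟨_, (isWeakPartial_weakPartial hu i).smul c⟩

lemma weakPartial_add {u v : L2per n} (hu : u ∈ H1per n) (hv : v ∈ H1per n) (i : Fin n) :
    weakPartial i (u + v) = weakPartial i u + weakPartial i v :=
  ((isWeakPartial_weakPartial hu i).add (isWeakPartial_weakPartial hv i)).weakPartial_eq

lemma weakPartial_smul (c : ℝ) {u : L2per n} (hu : u ∈ H1per n) (i : Fin n) :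
    weakPartial i (c • u) = c • weakPartial i u :=
  ((isWeakPartial_weakPartial hu i).smul c).weakPartial_eq

lemma fc_derivSymbol_zero (i : Fin n) : derivSymbol i (0 : Fin n → ℤ) = 0 := by
  simp [derivSymbol]

lemma integral_weakPartial {u : L2per n} (hu : u ∈ H1per n) (i : Fin n) :
    ∫ y in unitCell n, weakPartial i u y = 0 := by
  rw [integral_eq_zero_iff_fc, fc_weakPartial hu, fc_derivSymbol_zero, zero_mul]

lemma weakPartial_comm {u : L2per n} (hu : u ∈ H2per n) (i j : Fin n) :
    weakPartial i (weakPartial j u) = weakPartial j (weakPartial i u) := by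
  refine fc_injective fun k => ?_
  rw [fc_weakPartial (hu.2 j), fc_weakPartial (hu.2 i), fc_weakPartial hu.1, fc_weakPartial hu.1]
  ring

lemma inner_weakPartial_comm {u v : L2per n} (hu : u ∈ H1per n) (hv : v ∈ H1per n) (i j : Fin n) :
    inner ℝ (weakPartial j u) (weakPartial i v) = inner ℝ (weakPartial i u) (weakPartial j v) := by
  have h1 := hasSum_fc (weakPartial j u) (weakPartial i v)
  have h2 := hasSum_fc (weakPartial i u) (weakPartial j v)
  simp only [fc_weakPartial hu, fc_weakPartial hv, map_mul, conj_derivSymbol] at h1 h2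
  have h3 : (fun k => -derivSymbol j k * conj (fc u k) * (derivSymbol i k * fc v k)) =
      fun k => -derivSymbol i k * conj (fc u k) * (derivSymbol j k * fc v k) := by
    funext k
    ring
  rw [h3] at h1
  exact_mod_cast h1.unique h2

/-- `|Dv|²` integrates to `|∇·v|² + ½|Dv - (Dv)ᵀ|²`, in polarized form. -/
lemma sum_inner_jac {v w : Fin n → L2per n} (hv : ∀ i, v i ∈ H1per n) (hw : ∀ i, w i ∈ H1per n) :
    inner ℝ (divg v) (divg w) + (1 / 2) * ∑ i, ∑ j,
      inner ℝ (jac v i j - jac v j i) (jac w i j - jac w j i) =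
      ∑ i, ∑ j, inner ℝ (jac v i j) (jac w i j) := by
  have h1 : inner ℝ (divg v) (divg w) = ∑ i, ∑ j, inner ℝ (jac v i j) (jac w j i) := by
    simp only [divg, sum_inner, inner_sum, jac]
    rw [Finset.sum_comm]
    exact Finset.sum_congr rfl fun i _ => Finset.sum_congr rfl fun j _ =>
      (inner_weakPartial_comm (hv _) (hw _) _ _).symm
  have h2 : ∑ i, ∑ j, inner ℝ (jac v j i) (jac w j i) = ∑ i, ∑ j, inner ℝ (jac v i j) (jac w i j) :=
    Finset.sum_comm
  have h3 : ∑ i, ∑ j, inner ℝ (jac v j i) (jac w i j) = ∑ i, ∑ j, inner ℝ (jac v i j) (jac w j i) :=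
    Finset.sum_comm
  simp only [inner_sub_left, inner_sub_right, Finset.sum_sub_distrib, h1, h2, h3]
  ring

lemma norm_derivSymbol (i : Fin n) (k : Fin n → ℤ) :
    ‖derivSymbol i k‖ = 2 * Real.pi * |(k i : ℝ)| := by
  rw [derivSymbol, norm_mul, norm_mul, norm_mul, Complex.norm_I, Complex.norm_intCast,
    Complex.norm_real, Real.norm_of_nonneg Real.pi_pos.le]
  simp

lemma le_sum_norm_derivSymbol_sq {k : Fin n → ℤ} (hk : k ≠ 0) :
    4 * Real.pi ^ 2 ≤ ∑ i, ‖derivSymbol i k‖ ^ 2 := by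
  obtain ⟨i, hi⟩ := Function.ne_iff.1 hk
  refine le_trans ?_ (Finset.single_le_sum (f := fun i => ‖derivSymbol i k‖ ^ 2)
    (fun j _ => by positivity) (Finset.mem_univ i))
  have h1 : (1 : ℝ) ≤ |(k i : ℝ)| := by exact_mod_cast Int.one_le_abs hi
  simp only [norm_derivSymbol, mul_pow]
  nlinarith [Real.pi_pos, sq_nonneg Real.pi, mul_self_le_mul_self zero_le_one h1]

/-- The Poincaré inequality for periodic functions of mean zero. -/
lemma poincare {u : L2per n} (hu : u ∈ H1per n) (h0 : ∫ y in unitCell n, u y = 0) :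
    4 * Real.pi ^ 2 * ‖u‖ ^ 2 ≤ ∑ i, ‖weakPartial i u‖ ^ 2 := by
  have h1 := (hasSum_norm_fc u).mul_left (4 * Real.pi ^ 2)
  have h2 : HasSum (fun k => ∑ i, ‖fc (weakPartial i u) k‖ ^ 2) (∑ i, ‖weakPartial i u‖ ^ 2) :=
    hasSum_sum fun i _ => hasSum_norm_fc (weakPartial i u)
  refine hasSum_le (fun k => ?_) h1 h2
  simp only [fc_weakPartial hu, norm_mul, mul_pow, ← Finset.sum_mul]
  rcases eq_or_ne k 0 with rfl | hk
  · rw [(integral_eq_zero_iff_fc u).1 h0]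
    simp
  · exact mul_le_mul_of_nonneg_right (le_sum_norm_derivSymbol_sq hk) (by positivity)

/-! ### Inverting the Laplacian -/

/-- The Fourier symbol of the Laplacian. -/
def laplSymbol (k : Fin n → ℤ) : ℂ := ∑ i, derivSymbol i k ^ 2

lemma laplSymbol_eq (k : Fin n → ℤ) : laplSymbol k = -((∑ i, ‖derivSymbol i k‖ ^ 2 : ℝ) : ℂ) := by
  rw [laplSymbol, Complex.ofReal_sum, ← Finset.sum_neg_distrib]
  refine Finset.sum_congr rfl fun i _ => ?_
  rw [Complex.ofReal_pow, ← Complex.conj_mul', conj_derivSymbol]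
  ring

lemma norm_laplSymbol (k : Fin n → ℤ) : ‖laplSymbol k‖ = ∑ i, ‖derivSymbol i k‖ ^ 2 := by
  rw [laplSymbol_eq, norm_neg, Complex.norm_real, Real.norm_of_nonneg]
  positivity

lemma laplSymbol_ne_zero {k : Fin n → ℤ} (hk : k ≠ 0) : laplSymbol k ≠ 0 := by
  rw [← norm_pos_iff, norm_laplSymbol]
  exact lt_of_lt_of_le (by positivity) (le_sum_norm_derivSymbol_sq hk)

lemma norm_derivSymbol_le (i : Fin n) (k : Fin n → ℤ) : ‖derivSymbol i k‖ ^ 2 ≤ ‖laplSymbol k‖ := by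
  rw [norm_laplSymbol]
  exact Finset.single_le_sum (f := fun i => ‖derivSymbol i k‖ ^ 2)
    (fun j _ => by positivity) (Finset.mem_univ i)

lemma derivSymbol_neg (i : Fin n) (k : Fin n → ℤ) : derivSymbol i (-k) = -derivSymbol i k := by
  simp [derivSymbol]

lemma laplSymbol_neg (k : Fin n → ℤ) : laplSymbol (-k) = laplSymbol k := by
  simp [laplSymbol, derivSymbol_neg]

lemma conj_laplSymbol (k : Fin n → ℤ) : conj (laplSymbol k) = laplSymbol k := by
  simp [laplSymbol, conj_derivSymbol]

lemma norm_mul_inv_laplSymbol_le {z : ℂ} {k : Fin n → ℤ} (h : k ≠ 0 → ‖z‖ ≤ ‖laplSymbol k‖) :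
    ‖z * (laplSymbol k)⁻¹‖ ≤ 1 := by
  rcases eq_or_ne k 0 with rfl | hk
  · simp [laplSymbol, fc_derivSymbol_zero]
  · rw [norm_mul, norm_inv, ← div_eq_mul_inv]
    exact div_le_one_of_le₀ (h hk) (norm_nonneg _)

lemma one_le_norm_laplSymbol {k : Fin n → ℤ} (hk : k ≠ 0) : 1 ≤ ‖laplSymbol k‖ := by
  rw [norm_laplSymbol]
  refine le_trans ?_ (le_sum_norm_derivSymbol_sq hk)
  nlinarith [Real.pi_gt_three]

/-- Every mean-zero function is the Laplacian of a function in `H²_{per,0}(Y)`. -/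
lemma exists_lapl_eq {f : L2per n} (hf : ∫ y in unitCell n, f y = 0) :
    ∃ ψ ∈ H2per0 n, lapl ψ = f := by
  have hf0 := (integral_eq_zero_iff_fc f).1 hf
  obtain ⟨ψ, hψ⟩ := exists_fc_eq_mul (fun k => 1 * (laplSymbol k)⁻¹) 1
    (fun k => norm_mul_inv_laplSymbol_le fun hk => by
      rw [norm_one]; exact one_le_norm_laplSymbol hk)
    (fun k => by simp only [map_mul, map_inv₀, conj_laplSymbol, laplSymbol_neg, map_one]) f
  have hg : ∀ i, ∃ g : L2per n, ∀ k, fc g k = derivSymbol i k * (laplSymbol k)⁻¹ * fc f k := by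
    intro i
    refine exists_fc_eq_mul _ 1 (fun k => norm_mul_inv_laplSymbol_le fun hk => ?_)
      (fun k => by
        simp only [map_mul, map_inv₀, conj_laplSymbol, laplSymbol_neg, derivSymbol_neg,
          conj_derivSymbol]) f
    have h1 := one_le_norm_laplSymbol hk
    have h2 := norm_derivSymbol_le i k
    by_contra! h
    nlinarith [norm_nonneg (derivSymbol i k)]
  have hh : ∀ i j, ∃ g : L2per n, ∀ k,
      fc g k = derivSymbol i k * derivSymbol j k * (laplSymbol k)⁻¹ * fc f k := by
    intro i j
    refine exists_fc_eq_mul _ 1 (fun k => norm_mul_inv_laplSymbol_le fun _ => ?_)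
      (fun k => by
        simp only [map_mul, map_inv₀, conj_laplSymbol, laplSymbol_neg, derivSymbol_neg,
          conj_derivSymbol]) f
    have h1 := norm_derivSymbol_le i k
    have h2 := norm_derivSymbol_le j k
    rw [norm_mul]
    nlinarith [sq_nonneg (‖derivSymbol i k‖ - ‖derivSymbol j k‖)]
  choose g hg using hg
  choose h hh using hh
  have hψg : ∀ i, IsWeakPartial i ψ (g i) := fun i => isWeakPartial_iff_fc.2 fun k => by
    rw [hg, hψ]
    ring
  have hgh : ∀ i j, IsWeakPartial i (g j) (h i j) := fun i j => isWeakPartial_iff_fc.2 fun k => by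
    rw [hg, hh]
    ring
  refine ⟨ψ, ⟨⟨fun i => ⟨_, hψg i⟩, fun j => ?_⟩, ?_⟩, ?_⟩
  · rw [(hψg j).weakPartial_eq]
    exact fun i => ⟨_, hgh i j⟩
  · rw [integral_eq_zero_iff_fc, hψ, hf0, mul_zero]
  · simp only [lapl, (hψg _).weakPartial_eq, (hgh _ _).weakPartial_eq]
    refine fc_injective fun k => ?_
    simp only [fc_sum, hh, ← Finset.sum_mul]
    rcases eq_or_ne k 0 with rfl | hk
    · rw [hf0, mul_zero]
    · simp only [← pow_two]
      rw [← laplSymbol, mul_inv_cancel₀ (laplSymbol_ne_zero hk), one_mul]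

/-! ### Multiplication operators -/

/-- The space `L²(Y)^{n(n+1)}`, in which a vector field is recorded with its Jacobian. -/
abbrev JetSpace (n : ℕ) : Type := PiLp 2 fun _ : Fin n × Option (Fin n) => L2per n

/-- The coordinate projections of `JetSpace`. -/
def jetProj (p : Fin n × Option (Fin n)) : JetSpace n →L[ℝ] L2per n :=
  PiLp.proj (𝕜 := ℝ) 2 (fun _ : Fin n × Option (Fin n) => L2per n) p

lemma jetProj_apply (p : Fin n × Option (Fin n)) (x : JetSpace n) : jetProj p x = x p := rfl

lemma norm_sq_eq_integral (u : L2per n) : ‖u‖ ^ 2 = ∫ y in unitCell n, u y ^ 2 := by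
  rw [← real_inner_self_eq_norm_sq, ← integral_mul_eq_inner]
  simp only [pow_two]

lemma integrable_sq (u : L2per n) : Integrable (fun y => u y ^ 2) (cellMeasure n) :=
  (Lp.memLp u).integrable_sq

lemma exists_mulLp {c : (Fin n → ℝ) → ℝ} (hc : MemLp c ⊤ (cellMeasure n)) :
    ∃ M : L2per n →L[ℝ] L2per n, ∀ u, M u =ᵐ[cellMeasure n] fun y => c y * u y := by
  refine ⟨(ContinuousLinearMap.mul ℝ ℝ).holderL (cellMeasure n) ⊤ 2 2 (hc.toLp c), fun u => ?_⟩
  filter_upwards [(ContinuousLinearMap.mul ℝ ℝ).coeFn_holder (r := 2) (hc.toLp c) u,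
    hc.coeFn_toLp] with y h1 h2
  rw [ContinuousLinearMap.holderL_apply_apply, h1, h2, ContinuousLinearMap.mul_apply']

/-- Pairing with a field of coefficients of Euclidean length at most `√K`. -/
lemma exists_pairing {c : Fin n × Option (Fin n) → (Fin n → ℝ) → ℝ} {K : ℝ}
    (hm : ∀ p, AEStronglyMeasurable (c p) (cellMeasure n))
    (hK : ∀ᵐ y ∂cellMeasure n, ∑ p, c p y ^ 2 ≤ K) :
    ∃ R : JetSpace n →L[ℝ] L2per n,
      (∀ x, R x =ᵐ[cellMeasure n] fun y => ∑ p, c p y * x p y) ∧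
      ∀ x, ‖R x‖ ^ 2 ≤ K * ‖x‖ ^ 2 := by
  have hc : ∀ p, MemLp (c p) ⊤ (cellMeasure n) := by
    intro p
    refine memLp_top_of_bound (hm p) (Real.sqrt K) ?_
    filter_upwards [hK] with y hy
    refine Real.abs_le_sqrt (le_trans ?_ hy)
    exact Finset.single_le_sum (f := fun p => c p y ^ 2) (fun _ _ => sq_nonneg _)
      (Finset.mem_univ p)
  choose M hM using fun p => exists_mulLp (hc p)
  have hR : ∀ x : JetSpace n, (∑ p, M p ∘L jetProj p) x =ᵐ[cellMeasure n]
      fun y => ∑ p, c p y * x p y := by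
    intro x
    have h1 : (∑ p, M p ∘L jetProj p) x = ∑ p, M p (x p) := by
      simp [jetProj_apply]
    rw [h1]
    have h2 := Lp.coeFn_finsetSum Finset.univ (fun p => M p (x p))
    filter_upwards [h2, ae_all_iff.2 fun p => hM p (x p)] with y hy1 hy2
    rw [hy1, Finset.sum_apply]
    exact Finset.sum_congr rfl fun p _ => hy2 p
  refine ⟨∑ p, M p ∘L jetProj p, hR, fun x => ?_⟩
  have h3 : K * ‖x‖ ^ 2 = ∫ y in unitCell n, K * ∑ p, x p y ^ 2 := by
    rw [integral_const_mul, integral_finsetSum _ fun p _ => integrable_sq (x p),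
      PiLp.norm_sq_eq_of_L2]
    simp only [norm_sq_eq_integral]
  rw [norm_sq_eq_integral, h3]
  refine integral_mono_ae (integrable_sq _)
    ((integrable_finsetSum _ fun p _ => integrable_sq (x p)).const_mul _) ?_
  filter_upwards [hR x, hK] with y hy1 hy2
  rw [hy1]
  exact (Finset.sum_mul_sq_le_sq_mul_sq _ _ _).trans
    (mul_le_mul_of_nonneg_right hy2 (Finset.sum_nonneg fun _ _ => sq_nonneg _))

/-! ### The Cordes condition -/

section Pointwise

variable {A : (Fin n → ℝ) → Matrix (Fin n) (Fin n) ℝ} {b : (Fin n → ℝ) → Fin n → ℝ}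
  {x : Fin n → ℝ} {lam Lam δ : ℝ}

lemma diag_bounds (h : ∀ ξ : Fin n → ℝ,
    lam * (ξ ⬝ᵥ ξ) ≤ ξ ⬝ᵥ (A x *ᵥ ξ) ∧ ξ ⬝ᵥ (A x *ᵥ ξ) ≤ Lam * (ξ ⬝ᵥ ξ)) (i : Fin n) :
    lam ≤ A x i i ∧ A x i i ≤ Lam := by
  simpa using h (Pi.single i 1)

lemma trace_bounds (h : ∀ ξ : Fin n → ℝ,
    lam * (ξ ⬝ᵥ ξ) ≤ ξ ⬝ᵥ (A x *ᵥ ξ) ∧ ξ ⬝ᵥ (A x *ᵥ ξ) ≤ Lam * (ξ ⬝ᵥ ξ)) :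
    n * lam ≤ (A x).trace ∧ (A x).trace ≤ n * Lam := by
  have h1 := Finset.card_nsmul_le_sum Finset.univ (fun i => A x i i) lam
    fun i _ => (diag_bounds h i).1
  have h2 := Finset.sum_le_card_nsmul Finset.univ (fun i => A x i i) Lam
    fun i _ => (diag_bounds h i).2
  simpa [Matrix.trace] using And.intro h1 h2

lemma coeffSq_nonneg : 0 ≤ coeffSq A b x := by
  unfold coeffSq
  positivity

lemma coeffSq_pos (ht : 0 < (A x).trace) : 0 < coeffSq A b x := by
  refine coeffSq_nonneg.lt_of_ne fun h => ht.ne' ?_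
  have h0 : ∑ i, ∑ j, A x i j ^ 2 = 0 := by
    have h1 : 0 ≤ ∑ i, b x i ^ 2 := by positivity
    have h2 : 0 ≤ ∑ i, ∑ j, A x i j ^ 2 := by positivity
    unfold coeffSq at h
    linarith
  rw [Matrix.trace]
  refine Finset.sum_eq_zero fun i _ => ?_
  have h1 := (Finset.sum_eq_zero_iff_of_nonneg (fun i _ => by positivity)).1 h0 i
    (Finset.mem_univ i)
  have h2 := (Finset.sum_eq_zero_iff_of_nonneg (fun i _ => by positivity)).1 h1 i
    (Finset.mem_univ i)
  exact pow_eq_zero_iff two_ne_zero |>.1 h2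

/-- The deviation of `(Ã, b̃)` from `(Iₙ, 0)`. -/
def cordesDev (A : (Fin n → ℝ) → Matrix (Fin n) (Fin n) ℝ) (b : (Fin n → ℝ) → Fin n → ℝ)
    (p : Fin n × Option (Fin n)) (x : Fin n → ℝ) : ℝ :=
  p.2.elim (renormb A b x p.1) fun j => renormA A b x p.1 j - if p.1 = j then 1 else 0

lemma sum_cordesDev_sq (hS : coeffSq A b x ≠ 0) :
    ∑ p, cordesDev A b p x ^ 2 = n - (A x).trace ^ 2 / coeffSq A b x := by
  have h1 : ∀ i, ∑ j, (renormA A b x i j - if i = j then 1 else 0) ^ 2 =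
      renorm A b x ^ 2 * ∑ j, A x i j ^ 2 - 2 * renorm A b x * A x i i + 1 := by
    intro i
    have h2 : ∀ j, (renormA A b x i j - if i = j then 1 else 0) ^ 2 =
        renorm A b x ^ 2 * A x i j ^ 2 - (if i = j then 2 * renorm A b x * A x i j else 0) +
          (if i = j then 1 else 0) := by
      intro j
      simp only [renormA, Matrix.smul_apply, smul_eq_mul]
      split_ifs <;> ring
    simp only [h2, Finset.sum_add_distrib, Finset.sum_sub_distrib, Finset.mul_sum,
      Finset.sum_ite_eq, Finset.mem_univ, if_true]
  have h3 : renorm A b x ^ 2 * coeffSq A b x = (A x).trace ^ 2 / coeffSq A b x := by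
    rw [renorm]
    field_simp
  have h4 : renorm A b x * (A x).trace = (A x).trace ^ 2 / coeffSq A b x := by
    rw [renorm]
    ring
  have h5 : ∑ i, A x i i = (A x).trace := rfl
  simp only [Fintype.sum_prod_type, Fintype.sum_option, cordesDev, Option.elim, h1,
    Finset.sum_add_distrib, Finset.sum_sub_distrib, ← Finset.mul_sum, h5, Finset.sum_const,
    Finset.card_univ, Fintype.card_fin, nsmul_eq_mul, mul_one, renormb, Pi.smul_apply, smul_eq_mul,
    mul_pow]
  have h6 : renorm A b x ^ 2 * ∑ i, ∑ j, A x i j ^ 2 + renorm A b x ^ 2 * ∑ i, b x i ^ 2 =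
      (A x).trace ^ 2 / coeffSq A b x := by
    rw [← h3, coeffSq, mul_add]
  linarith

lemma sum_cordesDev_sq_le (ht : 0 < (A x).trace) (hδ : 0 < (n : ℝ) - 1 + δ)
    (hc : coeffSq A b x / (A x).trace ^ 2 ≤ 1 / ((n : ℝ) - 1 + δ)) :
    ∑ p, cordesDev A b p x ^ 2 ≤ 1 - δ := by
  have hS := coeffSq_pos (b := b) ht
  rw [sum_cordesDev_sq hS.ne']
  rw [div_le_div_iff₀ (by positivity) hδ] at hc
  have : (n : ℝ) - 1 + δ ≤ (A x).trace ^ 2 / coeffSq A b x := by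
    rw [le_div_iff₀ hS]
    linarith
  linarith

end Pointwise

lemma firstOrderOp_renorm (A : (Fin n → ℝ) → Matrix (Fin n) (Fin n) ℝ)
    (b : (Fin n → ℝ) → Fin n → ℝ) (w : Fin n → L2per n) (x : Fin n → ℝ) :
    firstOrderOp (renormA A b) (renormb A b) w x = renorm A b x * firstOrderOp A b w x := by
  simp only [firstOrderOp, renormA, renormb, Matrix.smul_apply, Pi.smul_apply, smul_eq_mul,
    mul_add, Finset.mul_sum, mul_assoc]

namespace CordesSetting

variable {A : (Fin n → ℝ) → Matrix (Fin n) (Fin n) ℝ} {b : (Fin n → ℝ) → Fin n → ℝ}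
  {lam Lam δ : ℝ}

lemma aemeasurable_A (h : CordesSetting lam Lam δ A b) (i j : Fin n) :
    AEMeasurable (fun x => A x i j) (cellMeasure n) :=
  (h.A_bounded i j).1.1.aemeasurable.restrict

lemma aemeasurable_b (h : CordesSetting lam Lam δ A b) (i : Fin n) :
    AEMeasurable (fun x => b x i) (cellMeasure n) :=
  (h.b_bounded i).1.1.aemeasurable.restrict

lemma aemeasurable_trace (h : CordesSetting lam Lam δ A b) :
    AEMeasurable (fun x => (A x).trace) (cellMeasure n) :=
  Finset.aemeasurable_fun_sum _ fun i _ => h.aemeasurable_A i i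

lemma aemeasurable_coeffSq (h : CordesSetting lam Lam δ A b) :
    AEMeasurable (coeffSq A b) (cellMeasure n) :=
  (Finset.aemeasurable_fun_sum _ fun i _ => Finset.aemeasurable_fun_sum _ fun j _ =>
    (h.aemeasurable_A i j).pow_const 2).add
    (Finset.aemeasurable_fun_sum _ fun i _ => (h.aemeasurable_b i).pow_const 2)

lemma aemeasurable_renorm (h : CordesSetting lam Lam δ A b) :
    AEMeasurable (renorm A b) (cellMeasure n) :=
  h.aemeasurable_trace.div h.aemeasurable_coeffSq

lemma aemeasurable_cordesDev (h : CordesSetting lam Lam δ A b) (p : Fin n × Option (Fin n)) :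
    AEMeasurable (cordesDev A b p) (cellMeasure n) := by
  rcases p with ⟨i, _ | j⟩
  · exact h.aemeasurable_renorm.mul (h.aemeasurable_b i)
  · exact (h.aemeasurable_renorm.mul (h.aemeasurable_A i j)).sub_const _

variable (hlam : 0 < lam) (hn : 0 < n) (hδ : 0 < (n : ℝ) - 1 + δ)
include hlam hn

lemma ae_trace (h : CordesSetting lam Lam δ A b) :
    ∀ᵐ x ∂cellMeasure n, 0 < (A x).trace ∧ (A x).trace ≤ n * Lam := by
  filter_upwards [ae_restrict_of_ae h.elliptic] with x hx
  have hn' : (0 : ℝ) < n := by exact_mod_cast hn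
  exact ⟨lt_of_lt_of_le (by positivity) (trace_bounds hx).1, (trace_bounds hx).2⟩

lemma ae_renorm_pos (h : CordesSetting lam Lam δ A b) :
    ∀ᵐ x ∂cellMeasure n, 0 < renorm A b x := by
  filter_upwards [h.ae_trace hlam hn] with x hx
  exact div_pos hx.1 (coeffSq_pos hx.1)

include hδ

lemma ae_cordesDev (h : CordesSetting lam Lam δ A b) :
    ∀ᵐ x ∂cellMeasure n, ∑ p, cordesDev A b p x ^ 2 ≤ 1 - δ := by
  filter_upwards [h.ae_trace hlam hn, ae_restrict_of_ae h.cordes] with x hx hc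
  exact sum_cordesDev_sq_le hx.1 hδ hc

lemma memLp_renormb (h : CordesSetting lam Lam δ A b) (j : Fin n) :
    MemLp (fun x => renormb A b x j) 2 (cellMeasure n) := by
  refine MemLp.of_bound (h.aemeasurable_cordesDev (j, none)).aestronglyMeasurable
    (Real.sqrt (1 - δ)) ?_
  filter_upwards [h.ae_cordesDev hlam hn hδ] with x hx
  refine Real.abs_le_sqrt (le_trans ?_ hx)
  exact Finset.single_le_sum (f := fun p => cordesDev A b p x ^ 2) (fun _ _ => sq_nonneg _)
    (Finset.mem_univ (j, none))

/-- `1/γ` is essentially bounded. -/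
lemma memLp_inv_renorm (h : CordesSetting lam Lam δ A b) :
    MemLp (fun x => (renorm A b x)⁻¹) ⊤ (cellMeasure n) := by
  refine memLp_top_of_bound h.aemeasurable_renorm.inv.aestronglyMeasurable
    (n * Lam / (n - 1 + δ)) ?_
  filter_upwards [h.ae_trace hlam hn, h.ae_renorm_pos hlam hn, ae_restrict_of_ae h.cordes]
    with x ht hr hc
  rw [Real.norm_of_nonneg (inv_pos.2 hr).le, renorm, inv_div]
  have ht' := ht.1
  rw [div_le_div_iff₀ (by positivity) hδ] at hc
  rw [div_le_div_iff₀ ht' hδ]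
  nlinarith [ht.2]

end CordesSetting

/-! ### Jets of vector fields -/

/-- The vector field `w` together with its Jacobian. -/
def jet (w : Fin n → L2per n) : JetSpace n :=
  WithLp.toLp 2 fun p => p.2.elim (w p.1) fun j => jac w p.1 j

lemma jet_none (w : Fin n → L2per n) (i : Fin n) : jet w (i, none) = w i := rfl

lemma jet_some (w : Fin n → L2per n) (i j : Fin n) : jet w (i, some j) = jac w i j := rfl

lemma jet_add {v w : Fin n → L2per n} (hv : ∀ i, v i ∈ H1per n) (hw : ∀ i, w i ∈ H1per n) :
    jet (v + w) = jet v + jet w := by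
  ext1 ⟨i, _ | j⟩
  · rfl
  · exact weakPartial_add (hv i) (hw i) j

lemma jet_smul (c : ℝ) {w : Fin n → L2per n} (hw : ∀ i, w i ∈ H1per n) :
    jet (c • w) = c • jet w := by
  ext1 ⟨i, _ | j⟩
  · rfl
  · exact weakPartial_smul c (hw i) j

/-- `H¹_{per,0}(Y;ℝⁿ)` as a linear subspace. -/
def H1per0Sub (n : ℕ) : Submodule ℝ (Fin n → L2per n) where
  carrier := H1per0Vec n
  zero_mem' i := by
    have h : (0 : L2per n) ∈ H1per n := fun j =>
      ⟨0, isWeakPartial_iff_fc.2 fun k => by rw [fc_zero, mul_zero]⟩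
    exact ⟨h, (integral_eq_zero_iff_fc 0).2 (fc_zero 0)⟩
  add_mem' {v w} hv hw i := by
    refine ⟨add_mem_H1per (hv i).1 (hw i).1, ?_⟩
    rw [integral_eq_zero_iff_fc, Pi.add_apply, fc_add,
      (integral_eq_zero_iff_fc _).1 (hv i).2, (integral_eq_zero_iff_fc _).1 (hw i).2, add_zero]
  smul_mem' c w hw i := by
    refine ⟨smul_mem_H1per c (hw i).1, ?_⟩
    rw [integral_eq_zero_iff_fc, Pi.smul_apply, fc_smul,
      (integral_eq_zero_iff_fc _).1 (hw i).2, mul_zero]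

lemma sub_mem_H1per0Vec {v w : Fin n → L2per n} (hv : v ∈ H1per0Vec n) (hw : w ∈ H1per0Vec n) :
    v - w ∈ H1per0Vec n := (H1per0Sub n).sub_mem hv hw

lemma jet_sub {v w : Fin n → L2per n} (hv : v ∈ H1per0Vec n) (hw : w ∈ H1per0Vec n) :
    jet (v - w) = jet v - jet w := by
  have h := jet_add (fun i => (sub_mem_H1per0Vec hv hw i).1) fun i => (hw i).1
  rw [sub_add_cancel] at h
  rw [h, add_sub_cancel_right]

lemma jac_sub {v w : Fin n → L2per n} (hv : v ∈ H1per0Vec n) (hw : w ∈ H1per0Vec n)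
    (i j : Fin n) : jac (v - w) i j = jac v i j - jac w i j := by
  rw [← jet_some, jet_sub hv hw]
  rfl

lemma isClosedSubspace_H1per0Sub : IsClosedSubspace (H1per0Sub n) :=
  ⟨fun _ h => h, fun _ _ _ hv _ => hv⟩

lemma norm_jet (w : Fin n → L2per n) : ‖jet w‖ = h1Norm w := by
  rw [PiLp.norm_eq_of_L2, h1Norm, Fintype.sum_prod_type]
  simp only [Fintype.sum_option, jet_none, jet_some, Finset.sum_add_distrib]

lemma jacNorm_nonneg (w : Fin n → L2per n) : 0 ≤ jacNorm w := Real.sqrt_nonneg _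

lemma jacNorm_sq (w : Fin n → L2per n) : jacNorm w ^ 2 = ∑ i, ∑ j, ‖jac w i j‖ ^ 2 :=
  Real.sq_sqrt (by positivity)

lemma norm_jet_sq (w : Fin n → L2per n) : ‖jet w‖ ^ 2 = ∑ i, ‖w i‖ ^ 2 + jacNorm w ^ 2 := by
  rw [norm_jet, h1Norm, Real.sq_sqrt (by positivity), jacNorm_sq]

lemma norm_jet_sq_le {w : Fin n → L2per n} (hw : w ∈ H1per0Vec n) :
    ‖jet w‖ ^ 2 ≤ (1 + 1 / (4 * Real.pi ^ 2)) * jacNorm w ^ 2 := by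
  have h1 : 4 * Real.pi ^ 2 * ∑ i, ‖w i‖ ^ 2 ≤ jacNorm w ^ 2 := by
    rw [jacNorm_sq, Finset.mul_sum]
    exact Finset.sum_le_sum fun i _ => poincare (hw i).1 (hw i).2
  have hpi : 0 < 4 * Real.pi ^ 2 := by positivity
  rw [norm_jet_sq, add_mul, one_mul, add_comm, one_div, inv_mul_eq_div]
  gcongr
  rw [le_div_iff₀ hpi]
  linarith

lemma eq_zero_of_jacNorm {w : Fin n → L2per n} (hw : w ∈ H1per0Vec n) (h : jacNorm w = 0) :
    w = 0 := by
  have h1 := norm_jet_sq_le hw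
  rw [h] at h1
  have h2 : ‖jet w‖ = 0 := by
    have := sq_nonneg ‖jet w‖
    exact pow_eq_zero_iff two_ne_zero |>.1 (by linarith)
  have h3 : jet w = 0 := norm_eq_zero.1 h2
  funext i
  rw [← jet_none w, h3]
  rfl

lemma continuous_fc (k : Fin n → ℤ) : Continuous fun u : L2per n => fc u k := by
  simp only [fc, HilbertBasis.repr_apply_apply]
  fun_prop

/-- The jets of the fields in a closed subspace of `H¹_{per,0}(Y;ℝⁿ)`. -/
def jetSub (P : Submodule ℝ (Fin n → L2per n)) (hP : (P : Set (Fin n → L2per n)) ⊆ H1per0Vec n) :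
    Submodule ℝ (JetSpace n) where
  carrier := jet '' P
  zero_mem' := ⟨0, P.zero_mem, by
    have h := jet_smul (0 : ℝ) fun i => (hP P.zero_mem i).1
    rwa [zero_smul, zero_smul] at h⟩
  add_mem' := by
    rintro _ _ ⟨v, hv, rfl⟩ ⟨w, hw, rfl⟩
    exact ⟨v + w, P.add_mem hv hw, jet_add (fun i => (hP hv i).1) fun i => (hP hw i).1⟩
  smul_mem' := by
    rintro c _ ⟨w, hw, rfl⟩
    exact ⟨c • w, P.smul_mem c hw, jet_smul c fun i => (hP hw i).1⟩

lemma isClosed_jetSub {P : Submodule ℝ (Fin n → L2per n)} (hP : IsClosedSubspace P) :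
    IsClosed (jetSub P hP.1 : Set (JetSpace n)) := by
  refine IsSeqClosed.isClosed fun x y hx hy => ?_
  choose w hwP hwx using hx
  have hcoord : ∀ p, Tendsto (fun k => x k p) atTop (𝓝 (y p)) := fun p =>
    ((jetProj p).continuous.tendsto y).comp hy
  have hfc : ∀ p l, Tendsto (fun k => fc (x k p) l) atTop (𝓝 (fc (y p) l)) := fun p l =>
    ((continuous_fc l).tendsto _).comp (hcoord p)
  have hpart : ∀ i j, IsWeakPartial j (y (i, none)) (y (i, some j)) := by
    intro i j
    rw [isWeakPartial_iff_fc]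
    intro l
    refine tendsto_nhds_unique (hfc (i, some j) l) (((hfc (i, none) l).const_mul _).congr ?_)
    intro k
    rw [← hwx k, jet_none, jet_some, jac, fc_weakPartial (hP.1 (hwP k) i).1]
  have hjet : jet (fun i => y (i, none)) = y := by
    ext1 ⟨i, _ | j⟩
    · rfl
    · exact (hpart i j).weakPartial_eq
  have hmem : (fun i => y (i, none)) ∈ H1per0Vec n := by
    intro i
    refine ⟨fun j => ⟨_, hpart i j⟩, (integral_eq_zero_iff_fc _).2 ?_⟩
    refine tendsto_nhds_unique (hfc (i, none) 0) (tendsto_const_nhds.congr fun k => ?_)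
    rw [← hwx k, jet_none, (integral_eq_zero_iff_fc _).1 (hP.1 (hwP k) i).2]
  refine ⟨_, hP.2 w _ hwP hmem ?_, hjet⟩
  have h1 := (tendsto_iff_norm_sub_tendsto_zero.1 hy)
  refine h1.congr fun k => ?_
  rw [← norm_jet, jet_sub (hP.1 (hwP k)) hmem, hjet, hwx k]

/-! ### The Lax–Milgram theorem on closed subspaces -/

lemma exists_solution_of_coercive {E : Type*} [NormedAddCommGroup E] [InnerProductSpace ℝ E]
    [CompleteSpace E] (B : E →L[ℝ] E →L[ℝ] ℝ) (l : E →L[ℝ] ℝ) {K : Submodule ℝ E}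
    (hK : IsClosed (K : Set E)) {c : ℝ} (hc : 0 < c) (hB : ∀ x ∈ K, c * ‖x‖ ^ 2 ≤ B x x) :
    ∃ u ∈ K, ∀ v ∈ K, B v u = l v := by
  have : CompleteSpace K := hK.completeSpace_coe
  have hco : IsCoercive (B.flip.bilinearComp K.subtypeL K.subtypeL) :=
    ⟨c, hc, fun x => by simpa [pow_two, mul_assoc] using hB x x.2⟩
  set f := (InnerProductSpace.toDual ℝ K).symm (l ∘L K.subtypeL)
  set u := hco.continuousLinearEquivOfBilin.symm f
  refine ⟨u, u.2, fun v hv => ?_⟩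
  have h1 := hco.continuousLinearEquivOfBilin_apply u ⟨v, hv⟩
  rw [ContinuousLinearEquiv.apply_symm_apply, InnerProductSpace.toDual_symm_apply] at h1
  simpa using h1.symm

/-! ### Perturbations of the Laplacian form -/

/-- The divergence of a jet. -/
def jetDiv (n : ℕ) : JetSpace n →L[ℝ] L2per n := ∑ i, jetProj (i, some i)

lemma jetDiv_jet (w : Fin n → L2per n) : jetDiv n (jet w) = divg w := by
  simp [jetDiv, jetProj_apply, jet_some, jac, divg]

/-- The bilinear form `(x,y) ↦ ⟪S x, T y⟫` on jets. -/
def innerPullback (S T : JetSpace n →L[ℝ] L2per n) : JetSpace n →L[ℝ] JetSpace n →L[ℝ] ℝ :=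
  (isBoundedBilinearMap_inner (𝕜 := ℝ) (E := L2per n)).toContinuousLinearMap.bilinearComp S T

lemma innerPullback_apply (S T : JetSpace n →L[ℝ] L2per n) (x y : JetSpace n) :
    innerPullback S T x y = inner ℝ (S x) (T y) := rfl

/-- The form `(v,w) ↦ ∫ (∇·v)(∇·w + R w) + ½ ∫ (Dv - (Dv)ᵀ):(Dw - (Dw)ᵀ)` on jets. -/
def jetForm (R : JetSpace n →L[ℝ] L2per n) : JetSpace n →L[ℝ] JetSpace n →L[ℝ] ℝ :=
  innerPullback (jetDiv n) (jetDiv n + R) + (1 / 2 : ℝ) • ∑ i, ∑ j,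
    innerPullback (jetProj (i, some j) - jetProj (j, some i))
      (jetProj (i, some j) - jetProj (j, some i))

lemma jetForm_jet (R : JetSpace n →L[ℝ] L2per n) (v w : Fin n → L2per n) :
    jetForm R (jet v) (jet w) = inner ℝ (divg v) (divg w + R (jet w)) + (1 / 2) * ∑ i, ∑ j,
      inner ℝ (jac v i j - jac v j i) (jac w i j - jac w j i) := by
  simp only [jetForm, add_apply, smul_apply, sum_apply, innerPullback_apply, jetDiv_jet, sub_apply,
    jetProj_apply, jet_some, smul_eq_mul]

lemma jetForm_jet_eq (R : JetSpace n →L[ℝ] L2per n) {v w : Fin n → L2per n}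
    (hv : v ∈ H1per0Vec n) (hw : w ∈ H1per0Vec n) :
    jetForm R (jet v) (jet w) =
      ∑ i, ∑ j, inner ℝ (jac v i j) (jac w i j) + inner ℝ (divg v) (R (jet w)) := by
  rw [jetForm_jet, ← sum_inner_jac (fun i => (hv i).1) fun i => (hw i).1, inner_add_right]
  ring

lemma norm_divg_le {w : Fin n → L2per n} (hw : w ∈ H1per0Vec n) : ‖divg w‖ ≤ jacNorm w := by
  refine abs_le_of_sq_le_sq' ?_ (jacNorm_nonneg w) |>.2
  have h := sum_inner_jac (fun i => (hw i).1) fun i => (hw i).1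
  simp only [real_inner_self_eq_norm_sq] at h
  rw [jacNorm_sq, ← h]
  have : 0 ≤ ∑ i, ∑ j, ‖jac w i j - jac w j i‖ ^ 2 := by positivity
  linarith

section Perturbation

variable {R : JetSpace n →L[ℝ] L2per n} {q : ℝ}
  (hR : ∀ w ∈ H1per0Vec n, ‖R (jet w)‖ ≤ q * jacNorm w)
include hR

lemma abs_inner_divg_le {v w : Fin n → L2per n} (hv : v ∈ H1per0Vec n) (hw : w ∈ H1per0Vec n) :
    |inner ℝ (divg v) (R (jet w))| ≤ q * (jacNorm v * jacNorm w) := by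
  refine (abs_real_inner_le_norm _ _).trans ?_
  calc ‖divg v‖ * ‖R (jet w)‖ ≤ jacNorm v * (q * jacNorm w) :=
        mul_le_mul (norm_divg_le hv) (hR w hw) (norm_nonneg _) (jacNorm_nonneg _)
    _ = q * (jacNorm v * jacNorm w) := by ring

lemma jetForm_coercive {w : Fin n → L2per n} (hw : w ∈ H1per0Vec n) :
    (1 - q) * jacNorm w ^ 2 ≤ jetForm R (jet w) (jet w) := by
  rw [jetForm_jet_eq R hw hw]
  simp only [real_inner_self_eq_norm_sq, ← jacNorm_sq]
  have h := (abs_le.1 (abs_inner_divg_le hR hw hw)).1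
  linarith

lemma jetForm_le {v w : Fin n → L2per n} (hv : v ∈ H1per0Vec n) (hw : w ∈ H1per0Vec n) :
    jetForm R (jet v) (jet w) ≤ (1 + q) * (jacNorm v * jacNorm w) := by
  rw [jetForm_jet_eq R hv hw, add_mul, one_mul]
  refine add_le_add ?_ (le_of_abs_le (abs_inner_divg_le hR hv hw))
  have h1 : ∑ i, ∑ j, inner ℝ (jac v i j) (jac w i j) ≤
      ∑ p : Fin n × Fin n, ‖jac v p.1 p.2‖ * ‖jac w p.1 p.2‖ := by
    rw [Fintype.sum_prod_type]
    exact Finset.sum_le_sum fun i _ => Finset.sum_le_sum fun j _ => real_inner_le_norm _ _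
  refine h1.trans ((Real.sum_mul_le_sqrt_mul_sqrt _ _ _).trans_eq ?_)
  simp only [Fintype.sum_prod_type]
  rfl

lemma eq_of_jetForm_eq (hq1 : q < 1) {P : Submodule ℝ (Fin n → L2per n)}
    (hP : (P : Set (Fin n → L2per n)) ⊆ H1per0Vec n) {ξ η : Fin n → L2per n} (hξ : ξ ∈ P)
    (hη : η ∈ P) (h : ∀ w ∈ P, jetForm R (jet w) (jet ξ) = jetForm R (jet w) (jet η)) : ξ = η := by
  have hd := P.sub_mem hξ hη
  have h1 := jetForm_coercive hR (hP hd)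
  have h2 : jetForm R (jet (ξ - η)) (jet (ξ - η)) = 0 := by
    nth_rewrite 2 [jet_sub (hP hξ) (hP hη)]
    rw [map_sub, h _ hd, sub_self]
  rw [h2] at h1
  have h3 : jacNorm (ξ - η) ^ 2 = 0 := le_antisymm (by nlinarith) (sq_nonneg _)
  exact sub_eq_zero.1 (eq_zero_of_jacNorm (hP hd) (pow_eq_zero_iff two_ne_zero |>.1 h3))

lemma exists_jetForm_eq (hq1 : q < 1) {P : Submodule ℝ (Fin n → L2per n)}
    (hP : IsClosedSubspace P) (β : L2per n) :
    ∃ ξ ∈ P, ∀ w ∈ P, jetForm R (jet w) (jet ξ) = -inner ℝ β (divg w) := by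
  have hpi : 0 < 1 + 1 / (4 * Real.pi ^ 2) := by positivity
  obtain ⟨_, ⟨ξ, hξ, rfl⟩, h⟩ := exists_solution_of_coercive (jetForm R)
    (-(innerSL ℝ β ∘L jetDiv n)) (isClosed_jetSub hP)
    (c := (1 - q) / (1 + 1 / (4 * Real.pi ^ 2))) (div_pos (by linarith) hpi) (by
      rintro _ ⟨w, hw, rfl⟩
      refine le_trans ?_ (jetForm_coercive hR (hP.1 hw))
      rw [div_mul_eq_mul_div, mul_div_assoc]
      refine mul_le_mul_of_nonneg_left ?_ (by linarith)
      rw [div_le_iff₀' hpi]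
      exact norm_jet_sq_le (hP.1 hw))
  refine ⟨ξ, hξ, fun w hw => ?_⟩
  rw [h _ ⟨w, hw, rfl⟩]
  simp [jetDiv_jet]

/-- Céa's lemma. -/
lemma h1Norm_sub_le (hq : 0 ≤ q) (hq1 : q < 1) {P : Submodule ℝ (Fin n → L2per n)}
    (hP : (P : Set (Fin n → L2per n)) ⊆ H1per0Vec n) {ξ η : Fin n → L2per n}
    (hξ : ξ ∈ H1per0Vec n) (hη : η ∈ P)
    (h : ∀ w ∈ P, jetForm R (jet w) (jet ξ) = jetForm R (jet w) (jet η)) :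
    h1Norm (ξ - η) ≤ Real.sqrt (1 + 1 / (4 * Real.pi ^ 2)) * ((1 + q) / (1 - q)) *
      ⨅ w : P, jacNorm (ξ - (w : Fin n → L2per n)) := by
  have hd := sub_mem_H1per0Vec hξ (hP hη)
  have hq' : 0 < 1 - q := by linarith
  have h1 : h1Norm (ξ - η) ≤ Real.sqrt (1 + 1 / (4 * Real.pi ^ 2)) * jacNorm (ξ - η) := by
    rw [← norm_jet]
    refine abs_le_of_sq_le_sq' ?_ (mul_nonneg (Real.sqrt_nonneg _) (jacNorm_nonneg _)) |>.2
    rw [mul_pow, Real.sq_sqrt (by positivity)]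
    exact norm_jet_sq_le hd
  have h2 : ∀ w : P, jacNorm (ξ - η) ≤
      (1 + q) / (1 - q) * jacNorm (ξ - (w : Fin n → L2per n)) := by
    intro w
    have hw := sub_mem_H1per0Vec hξ (hP w.2)
    have h3 := jetForm_coercive hR hd
    have h4 : jetForm R (jet (ξ - η)) (jet (ξ - η)) =
        jetForm R (jet (ξ - (w : Fin n → L2per n))) (jet (ξ - η)) := by
      have hm := P.sub_mem w.2 hη
      have h5 : ξ - η = (ξ - (w : Fin n → L2per n)) + ((w : Fin n → L2per n) - η) := by abel
      have h6 : jetForm R (jet ((w : Fin n → L2per n) - η)) (jet (ξ - η)) = 0 := by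
        rw [jet_sub hξ (hP hη), map_sub, h _ hm, sub_self]
      have h7 : jet (ξ - η) = jet (ξ - (w : Fin n → L2per n)) +
          jet ((w : Fin n → L2per n) - η) := by
        rw [← jet_add (fun i => (hw i).1) fun i => (hP hm i).1, ← h5]
      nth_rewrite 1 [h7]
      rw [map_add, add_apply, h6, add_zero]
    rw [h4] at h3
    have h8 := h3.trans (jetForm_le hR hw hd)
    rw [div_mul_eq_mul_div, le_div_iff₀ hq']
    rcases (jacNorm_nonneg (ξ - η)).eq_or_lt with h0 | h0
    · rw [← h0, zero_mul]
      exact mul_nonneg (by linarith) (jacNorm_nonneg _)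
    · nlinarith
  have hne : 0 ≤ (1 + q) / (1 - q) := div_nonneg (by linarith) hq'.le
  refine h1.trans ?_
  rw [mul_assoc, Real.mul_iInf_of_nonneg hne]
  exact mul_le_mul_of_nonneg_left (le_ciInf h2) (Real.sqrt_nonneg _)

end Perturbation

/-! ### Gradients -/

lemma grad_mem_H1per0Vec {u : L2per n} (hu : u ∈ H2per n) : grad u ∈ H1per0Vec n :=
  fun i => ⟨hu.2 i, integral_weakPartial hu.1 i⟩

lemma jac_grad_comm {u : L2per n} (hu : u ∈ H2per n) (i j : Fin n) :
    jac (grad u) i j = jac (grad u) j i := weakPartial_comm hu j i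

lemma divg_grad (u : L2per n) : divg (grad u) = lapl u := rfl

lemma secondOrderOp_eq {A : (Fin n → ℝ) → Matrix (Fin n) (Fin n) ℝ} {b : (Fin n → ℝ) → Fin n → ℝ}
    {u : L2per n} (hu : u ∈ H2per n) : secondOrderOp A b u = firstOrderOp A b (grad u) := by
  funext x
  simp only [secondOrderOp, firstOrderOp]
  congr 1
  refine Finset.sum_congr rfl fun i _ => Finset.sum_congr rfl fun j _ => ?_
  rw [weakPartial_comm hu]
  rfl

lemma grad_injOn : Set.InjOn (grad (n := n)) (H2per0 n) := by
  intro u hu v hv huv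
  refine fc_injective fun k => ?_
  rcases eq_or_ne k 0 with rfl | hk
  · rw [(integral_eq_zero_iff_fc u).1 hu.2, (integral_eq_zero_iff_fc v).1 hv.2]
  · obtain ⟨i, hi⟩ : ∃ i, derivSymbol i k ≠ 0 := by
      by_contra! h
      exact laplSymbol_ne_zero hk (by simp [laplSymbol, h])
    have h := congrArg (fun g => fc g k) (congrFun huv i)
    simp only [grad, fc_weakPartial hu.1.1, fc_weakPartial hv.1.1] at h
    exact mul_left_cancel₀ hi h

/-- A field in `H¹_{per,0}(Y;ℝⁿ)` without skew part is a gradient. -/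
lemma exists_grad_eq {w : Fin n → L2per n} (hw : w ∈ H1per0Vec n)
    (hs : ∀ φ ∈ H2per0 n, divg (w - grad φ) = 0 → ∀ i j,
      jac (w - grad φ) i j = jac (w - grad φ) j i) : ∃ φ ∈ H2per0 n, grad φ = w := by
  have h0 : ∫ y in unitCell n, divg w y = 0 := by
    rw [integral_eq_zero_iff_fc, divg, fc_sum]
    exact Finset.sum_eq_zero fun i _ =>
      (integral_eq_zero_iff_fc _).1 (integral_weakPartial (hw i).1 i)
  obtain ⟨φ, hφ, hlap⟩ := exists_lapl_eq h0
  have hg := grad_mem_H1per0Vec hφ.1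
  have hd := sub_mem_H1per0Vec hw hg
  have hdiv : divg (w - grad φ) = 0 := by
    rw [← jetDiv_jet, jet_sub hw hg, map_sub, jetDiv_jet, jetDiv_jet, divg_grad, hlap, sub_self]
  have h1 := sum_inner_jac (fun i => (hd i).1) fun i => (hd i).1
  have h2 : jacNorm (w - grad φ) ^ 2 = 0 := by
    simp only [real_inner_self_eq_norm_sq, ← jacNorm_sq] at h1
    rw [← h1, hdiv]
    simp [fun i j => sub_eq_zero.2 (hs φ hφ hdiv i j)]
  exact ⟨φ, hφ, (sub_eq_zero.1
    (eq_zero_of_jacNorm hd (pow_eq_zero_iff two_ne_zero |>.1 h2))).symm⟩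

lemma coeFn_sub_mul (f g : L2per n) (u v : L2per n) :
    (fun y => (f y - g y) * (u y - v y)) =ᵐ[cellMeasure n] fun y => (f - g) y * (u - v) y := by
  filter_upwards [Lp.coeFn_sub f g, Lp.coeFn_sub u v] with y h1 h2
  rw [h1, h2]
  rfl

lemma integrable_mul (f g : L2per n) : Integrable (fun y => f y * g y) (cellMeasure n) :=
  (Lp.memLp f).integrable_mul (Lp.memLp g)

lemma integral_skew (v w : Fin n → L2per n) :
    ∫ y in unitCell n, ∑ i, ∑ j, (jac v i j y - jac v j i y) * (jac w i j y - jac w j i y) =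
      ∑ i, ∑ j, inner ℝ (jac v i j - jac v j i) (jac w i j - jac w j i) := by
  have hi : ∀ i j, Integrable
      (fun y => (jac v i j y - jac v j i y) * (jac w i j y - jac w j i y)) (cellMeasure n) :=
    fun i j => (integrable_mul _ _).congr (coeFn_sub_mul _ _ _ _).symm
  rw [integral_finsetSum _ fun i _ => integrable_finsetSum _ fun j _ => hi i j]
  refine Finset.sum_congr rfl fun i _ => ?_
  rw [integral_finsetSum _ fun j _ => hi i j]
  refine Finset.sum_congr rfl fun j _ => ?_
  rw [integral_congr_ae (coeFn_sub_mul _ _ _ _), integral_mul_eq_inner]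

/-! ### The corrector problem -/

/-- The renormalized operator is a perturbation of the divergence. -/
lemma CordesSetting.exists_perturbation {A : (Fin n → ℝ) → Matrix (Fin n) (Fin n) ℝ}
    {b : (Fin n → ℝ) → Fin n → ℝ} {lam Lam δ : ℝ} (h : CordesSetting lam Lam δ A b)
    (hlam : 0 < lam) (hn : 0 < n) (hδ : 0 < (n : ℝ) - 1 + δ) :
    ∃ R : JetSpace n →L[ℝ] L2per n,
      (∀ w : Fin n → L2per n, firstOrderOp (renormA A b) (renormb A b) w =ᵐ[cellMeasure n]
        (divg w + R (jet w) : L2per n)) ∧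
      ∀ x, ‖R x‖ ^ 2 ≤ (1 - δ) * ‖x‖ ^ 2 := by
  obtain ⟨R, hR, hRn⟩ := exists_pairing (c := cordesDev A b)
    (fun p => (h.aemeasurable_cordesDev p).aestronglyMeasurable) (h.ae_cordesDev hlam hn hδ)
  refine ⟨R, fun w => ?_, hRn⟩
  filter_upwards [Lp.coeFn_add (divg w) (R (jet w)), hR (jet w),
    Lp.coeFn_finsetSum Finset.univ fun i => jac w i i] with y h1 h2 h3
  have h4 : divg w y = ∑ i, jac w i i y := by
    rw [← Finset.sum_apply, ← h3]
    rfl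
  have h5 : ∀ i, ∑ j, (renormA A b y i j - if i = j then 1 else 0) * jac w i j y =
      ∑ j, renormA A b y i j * jac w i j y - jac w i i y := by
    intro i
    simp only [sub_mul, Finset.sum_sub_distrib, ite_mul, one_mul, zero_mul, Finset.sum_ite_eq,
      Finset.mem_univ, if_true]
  rw [h1, Pi.add_apply, h2, h4]
  simp only [Fintype.sum_prod_type, Fintype.sum_option, cordesDev, Option.elim, jet_none, jet_some,
    h5, firstOrderOp, Finset.sum_add_distrib, Finset.sum_sub_distrib]
  ring

section Corrector

variable {A : (Fin n → ℝ) → Matrix (Fin n) (Fin n) ℝ} {b : (Fin n → ℝ) → Fin n → ℝ}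
  {R : JetSpace n →L[ℝ] L2per n}
  (hop : ∀ w : Fin n → L2per n, firstOrderOp (renormA A b) (renormb A b) w =ᵐ[cellMeasure n]
    (divg w + R (jet w) : L2per n))
include hop

lemma B2_eq_jetForm (v w : Fin n → L2per n) : B2 A b v w = jetForm R (jet v) (jet w) := by
  rw [B2, jetForm_jet, integral_skew, ← integral_mul_eq_inner]
  congr 1
  refine integral_congr_ae ?_
  filter_upwards [hop w] with y hy
  rw [hy]

lemma B1_eq_inner (φ : L2per n) {χ : L2per n} (hχ : χ ∈ H2per n) :
    B1 A b φ χ = inner ℝ (lapl φ) (divg (grad χ) + R (jet (grad χ))) := by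
  rw [B1, ← integral_mul_eq_inner, secondOrderOp_eq hχ]
  refine integral_congr_ae ?_
  filter_upwards [hop (grad χ)] with y hy
  rw [hy]

lemma B1_eq_B2 {φ χ : L2per n} (hφ : φ ∈ H2per n) (hχ : χ ∈ H2per n) :
    B1 A b φ χ = B2 A b (grad φ) (grad χ) := by
  rw [B1_eq_inner hop φ hχ, B2_eq_jetForm hop, jetForm_jet, divg_grad φ]
  simp [fun i j => sub_eq_zero.2 (jac_grad_comm hφ i j)]

lemma SolvesB2.solvesB1 {j : Fin n} {χ : L2per n} (hχ : χ ∈ H2per n)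
    (h : SolvesB2 A b j (H1per0Vec n) (grad χ)) : SolvesB1 A b j χ := by
  intro φ hφ
  rw [B1_eq_B2 hop hφ.1 hχ, h _ (grad_mem_H1per0Vec hφ.1)]
  rfl

/-- Testing against the invariant measure excludes nonzero constant multiples of `1/γ`. -/
lemma integral_invariant_div_renorm_ne_zero {q : ℝ} (hq1 : q < 1)
    (hR : ∀ w ∈ H1per0Vec n, ‖R (jet w)‖ ≤ q * jacNorm w)
    (hγ : ∀ᵐ y ∂cellMeasure n, 0 < renorm A b y) {r : L2per n} (hr : IsInvariantMeasure A b r)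
    {s : L2per n} (hs : s =ᵐ[cellMeasure n] fun y => (renorm A b y)⁻¹ * r y) :
    ∫ y in unitCell n, s y ≠ 0 := by
  intro h0
  obtain ⟨ψ, hψ, hlap⟩ := exists_lapl_eq h0
  have hg := grad_mem_H1per0Vec hψ.1
  have h1 : B1 A b ψ ψ = 0 := by
    rw [← hr.1 ψ hψ.1, B1, hlap]
    refine integral_congr_ae ?_
    filter_upwards [hs, hγ] with y h1 h2
    rw [h1, secondOrderOp_eq hψ.1, secondOrderOp_eq hψ.1, firstOrderOp_renorm]
    field_simp
  have h2 := jetForm_coercive hR hg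
  rw [← B2_eq_jetForm hop, ← B1_eq_B2 hop hψ.1 hψ.1, h1] at h2
  have h3 : jacNorm (grad ψ) ^ 2 = 0 := le_antisymm (by nlinarith) (sq_nonneg _)
  have h4 : s = 0 := by
    rw [← hlap, ← norm_eq_zero, ← divg_grad]
    exact le_antisymm ((norm_divg_le hg).trans_eq (pow_eq_zero_iff two_ne_zero |>.1 h3))
      (norm_nonneg _)
  have h5 : ∫ y in unitCell n, r y = 0 := by
    refine integral_eq_zero_of_ae ?_
    filter_upwards [hs, hγ, Lp.eq_zero_iff_ae_eq_zero.1 h4] with y h6 h7 h8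
    rw [h8, Pi.zero_apply, eq_comm, mul_eq_zero] at h6
    exact h6.resolve_left (inv_ne_zero h7.ne')
  rw [hr.2] at h5
  exact one_ne_zero h5

variable {j : Fin n} {β : L2per n} (hβ : β =ᵐ[cellMeasure n] fun y => renormb A b y j)
include hβ

lemma solvesB2_iff {S : Set (Fin n → L2per n)} {ξ : Fin n → L2per n} :
    SolvesB2 A b j S ξ ↔ ∀ w ∈ S, jetForm R (jet w) (jet ξ) = -inner ℝ β (divg w) := by
  refine forall₂_congr fun w _ => ?_
  rw [B2_eq_jetForm hop, ← integral_mul_eq_inner]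
  have h : ∫ y in unitCell n, renormb A b y j * divg w y = ∫ y in unitCell n, β y * divg w y := by
    refine integral_congr_ae ?_
    filter_upwards [hβ] with y hy
    rw [hy]
  rw [h]

lemma solvesCorrector_iff (hγ : ∀ᵐ y ∂cellMeasure n, 0 < renorm A b y) {χ : L2per n}
    (hχ : χ ∈ H2per n) : SolvesCorrector A b j χ ↔ divg (grad χ) + R (jet (grad χ)) = -β := by
  rw [Lp.ext_iff]
  refine ⟨fun h => ?_, fun h => ?_⟩
  · filter_upwards [h, hop (grad χ), hβ, Lp.coeFn_neg β] with y h1 h2 h3 h4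
    rw [← h2, h4, Pi.neg_apply, h3, firstOrderOp_renorm, ← secondOrderOp_eq hχ, renormb,
      Pi.smul_apply, ← h1, smul_eq_mul]
    ring
  · filter_upwards [h, hop (grad χ), hβ, Lp.coeFn_neg β, hγ] with y h1 h2 h3 h4 h5
    rw [← h2, h4, Pi.neg_apply, h3, firstOrderOp_renorm, ← secondOrderOp_eq hχ, renormb,
      Pi.smul_apply, smul_eq_mul, ← mul_neg] at h1
    rw [mul_left_cancel₀ h5.ne' h1, neg_neg]

/-- The corrector equation implies the variational problem for the gradient. -/
lemma SolvesCorrector.solvesB2 (hγ : ∀ᵐ y ∂cellMeasure n, 0 < renorm A b y) {χ : L2per n}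
    (hχ : χ ∈ H2per n) (h : SolvesCorrector A b j χ) (S : Set (Fin n → L2per n)) :
    SolvesB2 A b j S (grad χ) := by
  rw [solvesB2_iff hop hβ]
  intro w _
  rw [jetForm_jet, (solvesCorrector_iff hop hβ hγ hχ).1 h, inner_neg_right, real_inner_comm]
  simp [fun i j => sub_eq_zero.2 (jac_grad_comm hχ i j)]

/-- Any solution of the variational problem in `H¹_{per,0}(Y;ℝⁿ)` is a gradient. -/
lemma SolvesB2.exists_grad {ξ : Fin n → L2per n} (hξ : ξ ∈ H1per0Vec n)
    (h : SolvesB2 A b j (H1per0Vec n) ξ) : ∃ χ ∈ H2per0 n, grad χ = ξ := by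
  refine exists_grad_eq hξ fun φ hφ hdiv => ?_
  have hg := grad_mem_H1per0Vec hφ.1
  have h1 := (solvesB2_iff hop hβ).1 h _ (sub_mem_H1per0Vec hξ hg)
  have hskew : ∀ i l, jac ξ i l - jac ξ l i = jac (ξ - grad φ) i l - jac (ξ - grad φ) l i := by
    intro i l
    rw [jac_sub hξ hg, jac_sub hξ hg, jac_grad_comm hφ.1 i l]
    abel
  rw [jetForm_jet, hdiv, inner_zero_left, inner_zero_right, neg_zero, zero_add] at h1
  simp only [hskew, real_inner_self_eq_norm_sq] at h1
  have h2 : ∑ i, ∑ l, ‖jac (ξ - grad φ) i l - jac (ξ - grad φ) l i‖ ^ 2 = 0 := by linarith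
  intro i l
  have h3 := (Finset.sum_eq_zero_iff_of_nonneg (fun i _ => by positivity)).1 h2 i
    (Finset.mem_univ i)
  have h4 := (Finset.sum_eq_zero_iff_of_nonneg (fun i _ => by positivity)).1 h3 l
    (Finset.mem_univ l)
  exact sub_eq_zero.1 (norm_eq_zero.1 (pow_eq_zero_iff two_ne_zero |>.1 h4))

/-- The variational problem in `H²_{per,0}(Y)` implies the corrector equation, by the centering
condition. -/
lemma SolvesB1.solvesCorrector {q : ℝ} (hq1 : q < 1)
    (hR : ∀ w ∈ H1per0Vec n, ‖R (jet w)‖ ≤ q * jacNorm w)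
    (hγ : ∀ᵐ y ∂cellMeasure n, 0 < renorm A b y)
    (hγ' : MemLp (fun y => (renorm A b y)⁻¹) ⊤ (cellMeasure n))
    (hb : MemLp (fun y => b y j) ⊤ (cellMeasure n))
    {r : L2per n} (hr : IsInvariantMeasure A b r) (hcen : ∫ y in unitCell n, b y j * r y = 0)
    {χ : L2per n} (hχ : χ ∈ H2per0 n) (h : SolvesB1 A b j χ) : SolvesCorrector A b j χ := by
  set G : L2per n := divg (grad χ) + R (jet (grad χ)) + β with hG
  set c : ℝ := ∫ y in unitCell n, G y
  have hone : MemLp (fun _ : Fin n → ℝ => (1 : ℝ)) 2 (cellMeasure n) := memLp_const 1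
  set e : L2per n := hone.toLp _
  have he : e =ᵐ[cellMeasure n] fun _ => 1 := hone.coeFn_toLp
  have hinner : ∀ u : L2per n, inner ℝ u e = ∫ y in unitCell n, u y := by
    intro u
    rw [← integral_mul_eq_inner]
    refine integral_congr_ae ?_
    filter_upwards [he] with y hy
    rw [hy, mul_one]
  have hee : inner ℝ e e = 1 := by
    rw [hinner, integral_congr_ae he]
    simp
  have horth : ∀ f : L2per n, ∫ y in unitCell n, f y = 0 → inner ℝ f G = 0 := by
    intro f hf
    obtain ⟨φ, hφ, rfl⟩ := exists_lapl_eq hf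
    have h1 := h φ hφ
    have h2 : ∫ y in unitCell n, renormb A b y j * lapl φ y = inner ℝ (lapl φ) β := by
      rw [real_inner_comm, ← integral_mul_eq_inner]
      refine integral_congr_ae ?_
      filter_upwards [hβ] with y hy
      rw [hy]
    rw [B1_eq_inner hop φ hχ.1, h2] at h1
    rw [hG, inner_add_right, h1, neg_add_cancel]
  have hGc : G = c • e := by
    have hm : ∫ y in unitCell n, (G - c • e) y = 0 := by
      rw [← hinner, inner_sub_left, real_inner_smul_left, hee, hinner, mul_one, sub_self]
    have h1 : inner ℝ (G - c • e) (G - c • e) = 0 := by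
      rw [inner_sub_right]
      rw [real_inner_smul_right, horth _ hm, hinner, hm, mul_zero, sub_zero]
    exact sub_eq_zero.1 (inner_self_eq_zero.1 h1)
  have hae : ∀ᵐ y ∂cellMeasure n,
      secondOrderOp A b χ y = c * (renorm A b y)⁻¹ - b y j := by
    have h1 : (G : (Fin n → ℝ) → ℝ) =ᵐ[cellMeasure n] fun _ => c := by
      rw [hGc]
      filter_upwards [Lp.coeFn_smul c e, he] with y h1 h2
      rw [h1, Pi.smul_apply, h2, smul_eq_mul, mul_one]
    filter_upwards [h1, hop (grad χ), hβ, hγ, Lp.coeFn_add (divg (grad χ) + R (jet (grad χ))) β]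
      with y h1 h2 h3 h4 h5
    rw [h1, Pi.add_apply, ← h2, h3, firstOrderOp_renorm, ← secondOrderOp_eq hχ.1, renormb,
      Pi.smul_apply, smul_eq_mul] at h5
    rw [h5]
    field_simp
    ring
  obtain ⟨M, hM⟩ := exists_mulLp hγ'
  obtain ⟨M', hM'⟩ := exists_mulLp hb
  have hint : ∀ u : L2per n, Integrable u (cellMeasure n) := fun u =>
    (Lp.memLp u).integrable (by norm_num)
  have hc0 : c * ∫ y in unitCell n, M r y = 0 := by
    have h1 := hr.1 χ hχ.1
    have h2 : ∫ y in unitCell n, r y * secondOrderOp A b χ y =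
        ∫ y in unitCell n, (c * M r y - M' r y) := by
      refine integral_congr_ae ?_
      filter_upwards [hae, hM r, hM' r] with y h3 h4 h5
      rw [h3, h4, h5]
      ring
    rw [h2, integral_sub ((hint _).const_mul c) (hint _), integral_const_mul,
      integral_congr_ae (hM' r), hcen, sub_zero] at h1
    exact h1
  have hc : c = 0 := (mul_eq_zero.1 hc0).resolve_right
    (integral_invariant_div_renorm_ne_zero hop hq1 hR hγ hr (hM r))
  filter_upwards [hae] with y hy
  rw [hy, hc]
  ring

end Corrector

lemma cordes_ratio_lt_one {δ : ℝ} (hn : 0 < n) (hδ : (n : ℝ) / (n + Real.pi ^ 2) < δ) :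
    (1 - δ) * (1 + 1 / (4 * Real.pi ^ 2)) < 1 := by
  have hn' : (1 : ℝ) ≤ n := by exact_mod_cast hn
  have hpi : 0 < Real.pi ^ 2 := by positivity
  rw [div_lt_iff₀ (by positivity)] at hδ
  have h2 : (1 - δ) * (4 * Real.pi ^ 2 + 1) < 4 * Real.pi ^ 2 := by
    by_contra! h
    have hδ1 : δ ≤ 1 := by nlinarith
    nlinarith
  have h3 : 1 + 1 / (4 * Real.pi ^ 2) = (4 * Real.pi ^ 2 + 1) / (4 * Real.pi ^ 2) := by
    field_simp
  rw [h3, mul_div_assoc', div_lt_one (by positivity)]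
  exact h2

end PeriodicCorrector

end

open PeriodicCorrector in
theorem theorem4p3 (n : ℕ) (lam Lam δ : ℝ) (hlam : 0 < lam) (hLam : 0 < Lam)
    (hδ : (n : ℝ) / (n + Real.pi ^ 2) < δ) (hδ1 : δ ≤ 1) :
    ∃ C : ℝ, 0 < C ∧
      ∀ (A : (Fin n → ℝ) → Matrix (Fin n) (Fin n) ℝ) (b : (Fin n → ℝ) → Fin n → ℝ),
        PeriodicCorrector.CordesSetting lam Lam δ A b →
      ∀ r : PeriodicCorrector.L2per n, PeriodicCorrector.IsInvariantMeasure A b r →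
        (∀ i, ∫ y in PeriodicCorrector.unitCell n, b y i * r y = 0) →
      ∀ j : Fin n,
        ∃ χ : PeriodicCorrector.L2per n,
          (χ ∈ PeriodicCorrector.H2per0 n ∧ PeriodicCorrector.SolvesB1 A b j χ) ∧
          (∀ v ∈ PeriodicCorrector.H2per0 n, PeriodicCorrector.SolvesB1 A b j v → v = χ) ∧
          PeriodicCorrector.SolvesCorrector A b j χ ∧
          (∀ v ∈ PeriodicCorrector.H2per0 n, PeriodicCorrector.SolvesCorrector A b j v → v = χ) ∧
          (PeriodicCorrector.grad χ ∈ PeriodicCorrector.H1per0Vec n ∧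
            PeriodicCorrector.SolvesB2 A b j (PeriodicCorrector.H1per0Vec n)
              (PeriodicCorrector.grad χ)) ∧
          (∀ ξ ∈ PeriodicCorrector.H1per0Vec n,
            PeriodicCorrector.SolvesB2 A b j (PeriodicCorrector.H1per0Vec n) ξ →
              ξ = PeriodicCorrector.grad χ) ∧
          ∀ P : Submodule ℝ (Fin n → PeriodicCorrector.L2per n),
            PeriodicCorrector.IsClosedSubspace P →
            ∃ ξh : Fin n → PeriodicCorrector.L2per n,
              (ξh ∈ P ∧ PeriodicCorrector.SolvesB2 A b j P ξh) ∧
              (∀ η ∈ P, PeriodicCorrector.SolvesB2 A b j P η → η = ξh) ∧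
              PeriodicCorrector.h1Norm (PeriodicCorrector.grad χ - ξh) ≤
                C * ⨅ w : P, PeriodicCorrector.jacNorm
                  (PeriodicCorrector.grad χ - (w : Fin n → PeriodicCorrector.L2per n)) := by
  rcases Nat.eq_zero_or_pos n with rfl | hn
  · exact ⟨1, one_pos, fun _ _ _ _ _ _ j => j.elim0⟩
  have hδ' : 0 < (n : ℝ) - 1 + δ := by
    have h1 : (1 : ℝ) ≤ n := by exact_mod_cast hn
    have h2 : 0 < (n : ℝ) / (n + Real.pi ^ 2) := by positivity
    linarith
  have hpi : 0 < 1 + 1 / (4 * Real.pi ^ 2) := by positivity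
  have hq2 : 0 ≤ (1 - δ) * (1 + 1 / (4 * Real.pi ^ 2)) := mul_nonneg (by linarith) hpi.le
  obtain ⟨q, hq, hq1, hqs⟩ : ∃ q : ℝ, 0 ≤ q ∧ q < 1 ∧
      q ^ 2 = (1 - δ) * (1 + 1 / (4 * Real.pi ^ 2)) :=
    ⟨_, Real.sqrt_nonneg _, (Real.sqrt_lt_sqrt hq2 (cordes_ratio_lt_one hn hδ)).trans_eq
      Real.sqrt_one, Real.sq_sqrt hq2⟩
  refine ⟨Real.sqrt (1 + 1 / (4 * Real.pi ^ 2)) * ((1 + q) / (1 - q)),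
    mul_pos (Real.sqrt_pos.2 hpi) (div_pos (by linarith) (by linarith)), ?_⟩
  intro A b h r hr hcen j
  obtain ⟨R, hop, hRn⟩ := h.exists_perturbation hlam hn hδ'
  have hR : ∀ w ∈ H1per0Vec n, ‖R (jet w)‖ ≤ q * jacNorm w := by
    intro w hw
    refine abs_le_of_sq_le_sq' ?_ (mul_nonneg hq (jacNorm_nonneg w)) |>.2
    rw [mul_pow, hqs, mul_assoc]
    exact (hRn _).trans (mul_le_mul_of_nonneg_left (norm_jet_sq_le hw) (by linarith))
  have hγ := h.ae_renorm_pos hlam hn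
  have hβm := h.memLp_renormb hlam hn hδ' j
  have hβ := hβm.coeFn_toLp
  have hb : MemLp (fun y => b y j) ⊤ (cellMeasure n) := (h.b_bounded j).1.restrict _
  obtain ⟨ξ, hξ, hξs⟩ := exists_jetForm_eq hR hq1 isClosedSubspace_H1per0Sub (hβm.toLp _)
  have hξB : SolvesB2 A b j (H1per0Vec n) ξ := (solvesB2_iff hop hβ).2 hξs
  obtain ⟨χ, hχ, rfl⟩ := hξB.exists_grad hop hβ hξ
  have hB1 : ∀ v ∈ H2per0 n, SolvesB1 A b j v → SolvesCorrector A b j v := fun v hv hs =>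
    hs.solvesCorrector hop hβ hq1 hR hγ (h.memLp_inv_renorm hlam hn hδ') hb hr (hcen j) hv
  have huniq : ∀ η ∈ H1per0Vec n, SolvesB2 A b j (H1per0Vec n) η → η = grad χ := fun η hη hs =>
    eq_of_jetForm_eq hR hq1 isClosedSubspace_H1per0Sub.1 hη hξ fun w hw => by
      rw [(solvesB2_iff hop hβ).1 hs w hw, hξs w hw]
  have hcor : ∀ v ∈ H2per0 n, SolvesCorrector A b j v → v = χ := fun v hv hs =>
    grad_injOn hv hχ (huniq _ (grad_mem_H1per0Vec hv.1) (hs.solvesB2 hop hβ hγ hv.1 _))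
  have hχ1 : SolvesB1 A b j χ := hξB.solvesB1 hop hχ.1
  refine ⟨χ, ⟨hχ, hχ1⟩, fun v hv hs => hcor v hv (hB1 v hv hs), hB1 χ hχ hχ1, hcor, ⟨hξ, hξB⟩,
    huniq, fun P hP => ?_⟩
  obtain ⟨ξh, hξh, hsh⟩ := exists_jetForm_eq hR hq1 hP (hβm.toLp _)
  refine ⟨ξh, ⟨hξh, (solvesB2_iff hop hβ).2 hsh⟩, fun η hη hs => ?_, ?_⟩
  · exact eq_of_jetForm_eq hR hq1 hP.1 hη hξh fun w hw => by
      rw [(solvesB2_iff hop hβ).1 hs w hw, hsh w hw]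
  · exact h1Norm_sub_le hR hq hq1 hP.1 hξ hξh fun w hw => by
      rw [hξs w (hP.1 hw), hsh w hw]
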